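/- Let $\mathbb N=\{1,2,\dots\}$ and $\mathbb N_0=\{0,1,2,\dots\}$, and write $\overset{d}{=}$ for equality in distribution. For a prime $p$ let $|n|_p=p^{-v_p(n)}$ be the $p$-adic norm. (a) Let $X=(X_m)_{m\in\mathbb N_0}$ be a real-valued stochastic process such that $X_1$ is not almost surely $0$. Suppose that $X$ is marginally self-similar with scaling function $b:\mathbb N\to(0,\infty)$, i.e. $X_{nm}\overset{d}{=}b(n)X_m$ for all $n\in\mathbb N$, $m\in\mathbb N_0$, and that for some $\tau\in\mathbb N$ it has marginally cyclostationary increments with period $\tau$, i.e. $X_{m+1}-X_m\overset{d}{=}X_{m+k\tau+1}-X_{m+k\tau}$ for all $k,m\in\mathbb N_0$. Then $b$ is one of the following: 1. $b(n)=1$ for all $n\in\mathbb N$; 2. there exist a unique prime $p$ and some $H>0$ such that $b(n)=(|n|_p)^H$ for all $n\in\mathbb N$; 3. there exists $H>0$ such that $b(n)=n^H$ for all $n\in\mathbb N$. (b) A completely multiplicative function $b:\mathbb N\to(0,\infty)$ satisfies condition 2 if and only if there is a prime $p$ with $b(p)<1$ and $b(q)=1$ for every prime $q\neq p$. (c) Conversely,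 for every function $b$ on $\mathbb N$ satisfying one of the conditions 1, 2, 3 (each such function is completely multiplicative) there is a real-valued process $(X_m)_{m\in\mathbb N_0}$, with $X_1$ not almost surely equal to a constant, that is self-similar with scaling function $b$, i.e. $(X_{nm})_{m\in\mathbb N_0}\overset{d}{=}(b(n)X_m)_{m\in\mathbb N_0}$ for every $n\in\mathbb N$, and has stationary increments, i.e. $(X_{m+1}-X_m)_{m\in\mathbb N_0}\overset{d}{=}(X_{m+k+1}-X_{m+k})_{m\in\mathbb N_0}$ for every $k\in\mathbb N$ (equality in distribution of whole sequences in both cases). -/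

import Mathlib

open MeasureTheory ProbabilityTheory

namespace DtSsSi

/-- `X` is marginally self-similar with scaling function `b`: every `b n` is positive and
`X_{nm}` has the same distribution as `b(n) X_m`, for all `n ≥ 1` and `m ≥ 0`. -/
def MarginallySelfSimilar {Ω : Type*} [MeasurableSpace Ω] (μ : Measure Ω)
    (X : ℕ → Ω → ℝ) (b : ℕ+ → ℝ) : Prop :=
  (∀ n : ℕ+, 0 < b n) ∧
    ∀ (n : ℕ+) (m : ℕ), IdentDistrib (X ((n : ℕ) * m)) (fun ω => b n * X m ω) μ μ

/-- `X` has marginally cyclostationary increments with period `τ`: the increments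
`X_{m+1} - X_m` and `X_{m+kτ+1} - X_{m+kτ}` have the same distribution, for all `k, m ≥ 0`. -/
def MarginallyCyclostationaryIncrements {Ω : Type*} [MeasurableSpace Ω] (μ : Measure Ω)
    (X : ℕ → Ω → ℝ) (τ : ℕ+) : Prop :=
  ∀ k m : ℕ, IdentDistrib (fun ω => X (m + 1) ω - X m ω)
    (fun ω => X (m + k * (τ : ℕ) + 1) ω - X (m + k * (τ : ℕ)) ω) μ μ

/-- `X` is self-similar with scaling function `b`: every `b n` is positive and the whole
sequences `(X_{nm})_m` and `(b(n) X_m)_m` have the same law on `ℕ → ℝ`. -/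
def SelfSimilar {Ω : Type*} [MeasurableSpace Ω] (μ : Measure Ω)
    (X : ℕ → Ω → ℝ) (b : ℕ+ → ℝ) : Prop :=
  (∀ n : ℕ+, 0 < b n) ∧
    ∀ n : ℕ+, IdentDistrib (fun ω (m : ℕ) => X ((n : ℕ) * m) ω)
      (fun ω (m : ℕ) => b n * X m ω) μ μ

/-- `X` has stationary increments: the law on `ℕ → ℝ` of the increment sequence is invariant
under time shifts. -/
def StationaryIncrements {Ω : Type*} [MeasurableSpace Ω] (μ : Measure Ω)
    (X : ℕ → Ω → ℝ) : Prop :=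
  ∀ k : ℕ, IdentDistrib (fun ω (m : ℕ) => X (m + 1) ω - X m ω)
    (fun ω (m : ℕ) => X (m + k + 1) ω - X (m + k) ω) μ μ

/-- `b(n) = 1` for all `n`. -/
def TypeI (b : ℕ+ → ℝ) : Prop := ∀ n : ℕ+, b n = 1

/-- There is a unique prime `p` for which `b(n) = |n|_p ^ H` for some `H > 0`. -/
def TypeII (b : ℕ+ → ℝ) : Prop :=
  ∃! p : ℕ, p.Prime ∧ ∃ H : ℝ, 0 < H ∧
    ∀ n : ℕ+, b n = ((padicNorm p ((n : ℕ) : ℚ) : ℚ) : ℝ) ^ H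

/-- `b(n) = n ^ H` for some `H > 0`. -/
def TypeIII (b : ℕ+ → ℝ) : Prop :=
  ∃ H : ℝ, 0 < H ∧ ∀ n : ℕ+, b n = ((n : ℕ) : ℝ) ^ H

end DtSsSi

namespace DtSsSi

/-! Classification. The tail of a nonzero variable determines its scale, so `b` is completely
multiplicative (`MarginallySelfSimilar.map_mul`). The increments have at most `τ` different laws,
hence uniformly small tails. After scaling, this shows that `b` changes by a factor near one between
adjacent integers where it is large (`exists_forall_adjacent_lt_mul`).

If `b d > 1` for some `d`, then `log b` is an additive function, positive at `d`, with small
adjacent differences where it is large. `SlowlyVaryingWhereLarge.eq_log` forces such a function to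
be a multiple of `log`: some power of `n` lies very close to a power of `d`, and the two values are
then nearly equal.

If `b ≤ 1` throughout, two primes with `b < 1` are impossible (`eq_of_lt_one_of_lt_one`). They would
make `b` tiny at neighbours in some residue class modulo `τ`, so the increments of that class vanish
and `b n = b (n + 1)` on it. The class of `0` has no null increments, as `X 0 = 0` and `X 1 ≠ 0`. A
number built by the Chinese remainder theorem plays these facts against each other.

Converse. Each process is written so that scaling and shifting time become measure preserving
changes of variables. For type I a process constant in time suffices. For type II, coins indexed by
residues modulo `p ^ k` are summed with weights `c ^ k`. For type III, step functions with
frequencies in geometric progression, of random scale and phases, are superposed. -/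

/-! ### Additive functions that vary slowly where they are large. -/

theorem map_pow_of_additive {f : ℕ → ℝ} (hf : ∀ m n, 0 < m → 0 < n → f (m * n) = f m + f n)
    {d : ℕ} (hd : 0 < d) (k : ℕ) : f (d ^ k) = k * f d := by
  have h1 : f 1 = 0 := by
    have := hf 1 1 one_pos one_pos
    simp at this
    exact this
  induction k with
  | zero => simpa using h1
  | succ k ih => rw [pow_succ, hf _ _ (pow_pos hd k) hd, ih]; push_cast; ring

/-- `f` varies slowly, at neighbouring arguments, where it is large. -/
def SlowlyVaryingWhereLarge (f : ℕ → ℝ) : Prop :=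
  ∀ ε > 0, ∃ M : ℝ, ∀ m n : ℕ, 0 < m → 0 < n → (m = n + 1 ∨ n = m + 1) → M < f n →
    |f m - f n| ≤ ε

theorem SlowlyVaryingWhereLarge.bounded_shift {f : ℕ → ℝ} (hs : SlowlyVaryingWhereLarge f)
    (J : ℕ) {ε : ℝ} (hε : 0 < ε) :
    ∃ M : ℝ, ∀ n : ℕ, 0 < n → M < f n → ∀ r ≤ J, |f (n + r) - f n| ≤ ε := by
  have hJ : (0 : ℝ) < J + 1 := by positivity
  obtain ⟨M, hM⟩ := hs (ε / (J + 1)) (by positivity)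
  refine ⟨M + ε, fun n hn hMn => ?_⟩
  have key : ∀ r ≤ J, |f (n + r) - f n| ≤ r * (ε / (J + 1)) := by
    intro r
    induction r with
    | zero => simp
    | succ r ih =>
      intro hr
      have h1 := ih (by omega)
      have h2 : (r : ℝ) * (ε / (J + 1)) ≤ ε := by
        rw [mul_div_assoc', div_le_iff₀ hJ]
        have : (r : ℝ) ≤ J + 1 := by exact_mod_cast (by omega : r ≤ J + 1)
        nlinarith
      have h3 := hM (n + (r + 1)) (n + r) (by omega) (by omega) (Or.inl (by omega))
        (by have := (abs_le.1 h1).1; linarith)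
      push_cast
      rw [abs_le] at *
      constructor <;> linarith [h1.1, h1.2, h3.1, h3.2]
  intro r hr
  refine (key r hr).trans ?_
  rw [mul_div_assoc', div_le_iff₀ hJ]
  have : (r : ℝ) ≤ J + 1 := by exact_mod_cast (by omega : r ≤ J + 1)
  nlinarith

/-- Numbers close to a power `d ^ a` have nearly the value `a * f d`. -/
theorem SlowlyVaryingWhereLarge.near_pow {f : ℕ → ℝ} (hs : SlowlyVaryingWhereLarge f)
    (hf : ∀ m n, 0 < m → 0 < n → f (m * n) = f m + f n) {d : ℕ} (hd : 2 ≤ d) (hfd : 0 < f d)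
    {ε : ℝ} (hε : 0 < ε) (hεd : ε ≤ f d) :
    ∃ j : ℕ, 0 < j ∧ ∀ i x : ℕ, d ^ i * (d ^ j - 1) ≤ x → x ≤ d ^ i * (d ^ j + 1) →
      |f x - (i + j : ℕ) * f d| ≤ (i + 1) * ε := by
  obtain ⟨M₁, hM₁⟩ := hs ε hε
  obtain ⟨M₂, hM₂⟩ := hs.bounded_shift d hε
  -- Each level gains `f d` and loses at most `ε ≤ f d`, so a start with `j₀ * f d` above both
  -- thresholds keeps every later value above them.
  obtain ⟨j₀, hj₀⟩ := exists_nat_gt ((max M₁ M₂) / f d)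
  rw [div_lt_iff₀ hfd] at hj₀
  have hdj : ∀ j, 0 < j → 2 ≤ d ^ j := fun j hj =>
    hd.trans (Nat.le_self_pow hj.ne' d)
  refine ⟨j₀ + 1, by omega, fun i => ?_⟩
  induction i with
  | zero =>
    intro x hx1 hx2
    simp only [pow_zero, one_mul] at hx1 hx2
    have h2 := hdj (j₀ + 1) (by omega)
    have hpow := map_pow_of_additive hf (by omega : 0 < d) (j₀ + 1)
    push_cast at hpow
    rcases (by omega : x = d ^ (j₀ + 1) ∨ (x = d ^ (j₀ + 1) + 1 ∨ d ^ (j₀ + 1) = x + 1))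
      with h | h
    · rw [h, hpow]; simp [hε.le]
    · have := hM₁ x (d ^ (j₀ + 1)) (by omega) (by omega) h (by
        rw [hpow]; have := le_max_left M₁ M₂; nlinarith)
      rw [hpow] at this
      simpa using this
  | succ i ih =>
    intro x hx1 hx2
    have h2 := hdj (j₀ + 1) (by omega)
    have hd0 : 0 < d := by omega
    -- Division by `d` sends this window into the previous one; restoring the remainder `x % d` is a
    -- shift by less than `d`, which costs `ε`.
    have hy1 : d ^ i * (d ^ (j₀ + 1) - 1) ≤ x / d := by
      rw [Nat.le_div_iff_mul_le hd0]
      calc _ = d ^ (i + 1) * (d ^ (j₀ + 1) - 1) := by ring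
        _ ≤ x := hx1
    have hy2 : x / d ≤ d ^ i * (d ^ (j₀ + 1) + 1) := by
      apply Nat.div_le_of_le_mul
      calc x ≤ d ^ (i + 1) * (d ^ (j₀ + 1) + 1) := hx2
        _ = _ := by ring
    have hpos : 0 < x / d := lt_of_lt_of_le
      (Nat.mul_pos (pow_pos hd0 i) (by omega)) hy1
    have h := ih _ hy1 hy2
    have hmul := hf d (x / d) hd0 hpos
    have hbig : M₂ < f (d * (x / d)) := by
      rw [hmul]
      have h1 := (abs_le.1 h).1
      have := le_max_right M₁ M₂
      push_cast at h1
      have h3 : (i + 1 : ℝ) * ε ≤ (i + 1) * f d := by gcongr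
      nlinarith
    have h4 := hM₂ _ (Nat.mul_pos hd0 hpos) hbig (x % d) (Nat.mod_lt _ hd0).le
    rw [Nat.div_add_mod, hmul] at h4
    push_cast at h ⊢
    rw [abs_le] at *
    constructor <;> linarith [h.1, h.2, h4.1, h4.2]

/-- If `n ^ K` lies in the window around `d ^ (i + j)`, then `K * f n` is `(i + j) * f d` up to `(i
+ 1) * ε`. As `i + 1` is at most a fixed multiple of `K`, dividing by `K` leaves an error of order
`ε`. -/
theorem SlowlyVaryingWhereLarge.eq_log {f : ℕ → ℝ} (hs : SlowlyVaryingWhereLarge f)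
    (hf : ∀ m n, 0 < m → 0 < n → f (m * n) = f m + f n) {d : ℕ} (hd : 2 ≤ d) (hfd : 0 < f d)
    {n : ℕ} (hn : 2 ≤ n) : f n * Real.log d = f d * Real.log n := by
  have hld : 0 < Real.log d := Real.log_pos (by exact_mod_cast hd)
  have hln : 0 < Real.log n := Real.log_pos (by exact_mod_cast hn)
  have hdR : (0 : ℝ) < d := by exact_mod_cast (by omega : 0 < d)
  have hnR : (0 : ℝ) < n := by exact_mod_cast (by omega : 0 < n)
  set ξ := Real.log n / Real.log d with hξ
  have hξ0 : 0 < ξ := div_pos hln hld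
  have main : ∀ ε > 0, ε ≤ f d →
      |f n * Real.log d - f d * Real.log n| ≤ ε * (Real.log d * (ξ + 2 + f d)) := by
    intro ε hε hεd
    obtain ⟨j, hj, hnear⟩ := hs.near_pow hf hd hfd hε hεd
    -- Approximating multiples of `L₀ * ξ > j + 1`, rather than of `ξ`, guarantees that the exponent
    -- `a` of `d` is at least `j`.
    obtain ⟨L₀, hL₀⟩ := exists_nat_gt ((j + 1) / ξ)
    rw [div_lt_iff₀ hξ0] at hL₀
    have hL : 0 < L₀ := by
      rcases Nat.eq_zero_or_pos L₀ with h | h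
      · rw [h] at hL₀; simp at hL₀; have : (0:ℝ) ≤ j := by positivity
        linarith
      · exact h
    have hq : (0 : ℝ) < ((d : ℝ) ^ j)⁻¹ := by positivity
    -- The three bounds serve, in order, the upper end of the window, its lower end through `1 + x ≤
    -- exp x`, and the final error together with the bound on `i`.
    set η := min (Real.log (1 + ((d : ℝ) ^ j)⁻¹)) (min ((d : ℝ) ^ j)⁻¹ (min ε 1 * Real.log d))
      with hη
    have hη0 : 0 < η := lt_min (Real.log_pos (by linarith))
      (lt_min hq (mul_pos (lt_min hε one_pos) hld))
    obtain ⟨N, hN⟩ := exists_nat_gt (Real.log d / η)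
    have hN0 : 0 < N := by
      have : (0 : ℝ) < N := lt_trans (div_pos hld hη0) hN
      exact_mod_cast this
    -- Dirichlet approximation: `n ^ (L₀ * k)` is within a factor `exp η` of `d ^ a`.
    obtain ⟨a, k, hk0, -, hak⟩ := Real.exists_int_int_abs_mul_sub_le (L₀ * ξ) hN0
    have hNη : 1 / ((N : ℝ) + 1) * Real.log d ≤ η := by
      rw [div_lt_iff₀ hη0] at hN
      rw [div_mul_eq_mul_div, one_mul, div_le_iff₀ (by positivity)]
      nlinarith
    have hk1 : (1 : ℝ) ≤ k := by exact_mod_cast hk0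
    have hN1 : 1 / ((N : ℝ) + 1) ≤ 1 := by
      rw [div_le_one (by positivity)]; linarith [(Nat.cast_nonneg N : (0:ℝ) ≤ N)]
    have haj : (j : ℤ) ≤ a := by
      have h1 := (abs_le.1 hak).2
      have h2 : (j : ℝ) ≤ a := by nlinarith
      exact_mod_cast h2
    lift k to ℕ using hk0.le
    lift a to ℕ using (by omega)
    obtain ⟨i, rfl⟩ := Nat.exists_eq_add_of_le' (by exact_mod_cast haj : j ≤ a)
    set K := L₀ * k with hK
    have hK1 : (1 : ℝ) ≤ K := by
      exact_mod_cast Nat.mul_pos hL (by exact_mod_cast hk0)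
    have hlog : |(K : ℝ) * Real.log n - (i + j : ℕ) * Real.log d| ≤ η := by
      refine le_trans ?_ hNη
      have e : (K : ℝ) * Real.log n - (i + j : ℕ) * Real.log d =
          ((L₀ : ℝ) * ξ * k - (i + j : ℕ)) * Real.log d := by
        rw [hξ, hK]; push_cast; field_simp
      rw [e, abs_mul, abs_of_pos hld]
      refine mul_le_mul_of_nonneg_right ?_ hld.le
      rw [mul_comm ((L₀ : ℝ) * ξ)]
      exact_mod_cast hak
    have hexp : ((n ^ K : ℕ) : ℝ) = (d : ℝ) ^ (i + j) *
        Real.exp ((K : ℝ) * Real.log n - (i + j : ℕ) * Real.log d) := by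
      rw [Real.exp_sub, mul_comm (K : ℝ), mul_comm ((i + j : ℕ) : ℝ), ← Real.rpow_def_of_pos hnR,
        ← Real.rpow_def_of_pos hdR, Real.rpow_natCast, Real.rpow_natCast]
      push_cast
      field_simp
    have hup : n ^ K ≤ d ^ i * (d ^ j + 1) := by
      have h1 : Real.exp ((K : ℝ) * Real.log n - (i + j : ℕ) * Real.log d) ≤
          1 + ((d : ℝ) ^ j)⁻¹ := by
        rw [← Real.le_log_iff_exp_le (by positivity)]
        exact ((le_abs_self _).trans hlog).trans (min_le_left _ _)
      have h2 : ((n ^ K : ℕ) : ℝ) ≤ (d : ℝ) ^ i * (d ^ j + 1) := by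
        rw [hexp]
        calc _ ≤ (d : ℝ) ^ (i + j) * (1 + ((d : ℝ) ^ j)⁻¹) := by gcongr
          _ = _ := by rw [pow_add]; field_simp
      exact_mod_cast h2
    have hlow : d ^ i * (d ^ j - 1) ≤ n ^ K := by
      have h1 : 1 - ((d : ℝ) ^ j)⁻¹ ≤
          Real.exp ((K : ℝ) * Real.log n - (i + j : ℕ) * Real.log d) := by
        have := Real.add_one_le_exp ((K : ℝ) * Real.log n - (i + j : ℕ) * Real.log d)
        have h3 := (abs_le.1 hlog).1
        have h4 : η ≤ ((d : ℝ) ^ j)⁻¹ := (min_le_right _ _).trans (min_le_left _ _)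
        linarith
      have h2 : (d : ℝ) ^ i * (d ^ j - 1) ≤ ((n ^ K : ℕ) : ℝ) := by
        rw [hexp]
        calc (d : ℝ) ^ i * (d ^ j - 1) = (d : ℝ) ^ (i + j) * (1 - ((d : ℝ) ^ j)⁻¹) := by
              rw [pow_add]; field_simp
          _ ≤ _ := by gcongr
      have h5 : 1 ≤ d ^ j := Nat.one_le_pow _ _ (by omega)
      have h6 : ((d ^ i * (d ^ j - 1) : ℕ) : ℝ) ≤ ((n ^ K : ℕ) : ℝ) := by
        push_cast [Nat.cast_sub h5] at h2 ⊢
        exact h2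
      exact_mod_cast h6
    have hfin := hnear i (n ^ K) hlow hup
    rw [map_pow_of_additive hf (by omega : 0 < n)] at hfin
    have hηε : η ≤ ε * Real.log d := by
      refine ((min_le_right _ _).trans (min_le_right _ _)).trans ?_
      gcongr; exact min_le_left _ _
    have hη1 : η ≤ Real.log d := by
      refine ((min_le_right _ _).trans (min_le_right _ _)).trans ?_
      calc _ ≤ 1 * Real.log d := by gcongr; exact min_le_right _ _
        _ = _ := one_mul _
    have hξn : ξ * Real.log d = Real.log n := by rw [hξ]; field_simp
    have hibound : (i : ℝ) + 1 ≤ K * (ξ + 2) := by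
      have h1 := (abs_le.1 hlog).1
      push_cast at h1
      have h2 : ((i : ℝ) + j) * Real.log d ≤ (K * ξ + 1) * Real.log d := by
        have : (K * ξ + 1) * Real.log d = K * Real.log n + Real.log d := by rw [← hξn]; ring
        linarith
      have h3 := le_of_mul_le_mul_right h2 hld
      have : (0 : ℝ) ≤ j := by positivity
      nlinarith
    have e : (K : ℝ) * (f n * Real.log d - f d * Real.log n) =
        (K * f n - (i + j : ℕ) * f d) * Real.log d -
          f d * (K * Real.log n - (i + j : ℕ) * Real.log d) := by ring
    have habs : (K : ℝ) * |f n * Real.log d - f d * Real.log n| ≤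
        K * (ε * (Real.log d * (ξ + 2 + f d))) := by
      rw [← abs_of_nonneg (by positivity : (0 : ℝ) ≤ K), ← abs_mul, e,
        abs_of_nonneg (by positivity : (0 : ℝ) ≤ K)]
      calc _ ≤ |(K * f n - (i + j : ℕ) * f d) * Real.log d| +
            |f d * (K * Real.log n - (i + j : ℕ) * Real.log d)| := abs_sub _ _
        _ = |K * f n - (i + j : ℕ) * f d| * Real.log d +
            f d * |K * Real.log n - (i + j : ℕ) * Real.log d| := by
              rw [abs_mul, abs_mul, abs_of_pos hld, abs_of_pos hfd]
        _ ≤ (K * (ξ + 2) * ε) * Real.log d + f d * (ε * Real.log d) := by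
              gcongr
              · exact hfin.trans (by gcongr)
              · exact hlog.trans hηε
        _ ≤ (K * (ξ + 2) * ε) * Real.log d + K * (f d * (ε * Real.log d)) := by
              refine add_le_add le_rfl ?_
              exact le_mul_of_one_le_left (mul_nonneg hfd.le (mul_nonneg hε.le hld.le)) hK1
        _ = _ := by ring
    exact le_of_mul_le_mul_left habs (by linarith)
  set C := Real.log d * (ξ + 2 + f d) with hC
  have hC0 : 0 < C := by positivity
  by_contra hne
  have hpos : 0 < |f n * Real.log d - f d * Real.log n| := abs_pos.2 (sub_ne_zero.2 hne)
  set A := |f n * Real.log d - f d * Real.log n|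
  have h1 := main (min (f d) (A / (2 * C))) (lt_min hfd (by positivity)) (min_le_left _ _)
  have h2 : min (f d) (A / (2 * C)) * C ≤ A / 2 := by
    calc _ ≤ A / (2 * C) * C := by gcongr; exact min_le_right _ _
      _ = A / 2 := by field_simp
  linarith

/-! ### Tails and scales of real random variables. -/

section Tail

open Filter Topology

variable {Ω : Type*} [MeasurableSpace Ω] {μ : Measure Ω} {Y Z : Ω → ℝ}

theorem tail_anti {x y : ℝ} (h : x ≤ y) : μ {ω | y < |Z ω|} ≤ μ {ω | x < |Z ω|} :=
  measure_mono fun _ hω => lt_of_le_of_lt h hω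

theorem tendsto_tail [IsFiniteMeasure μ] (hZ : AEMeasurable Z μ) :
    Tendsto (fun x : ℝ => μ {ω | x < |Z ω|}) atTop (𝓝 0) := by
  have h := tendsto_measure_iInter_atTop (μ := μ) (s := fun x : ℝ => {ω | x < |Z ω|})
    (fun x => nullMeasurableSet_lt aemeasurable_const hZ.abs)
    (fun x y hxy ω hω => lt_of_le_of_lt hxy hω) ⟨0, measure_ne_top _ _⟩
  have e : (⋂ x : ℝ, {ω | x < |Z ω|}) = ∅ := by
    ext ω
    simp only [Set.mem_iInter, Set.mem_ofPred_eq, Set.mem_empty_iff_false, iff_false, not_forall]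
    exact ⟨|Z ω|, lt_irrefl _⟩
  rwa [e, measure_empty] at h

theorem ae_eq_zero_of_tail_eq_zero (h : ∀ x > 0, μ {ω | x < |Z ω|} = 0) : ∀ᵐ ω ∂μ, Z ω = 0 := by
  have h1 : ∀ᵐ ω ∂μ, ∀ k : ℕ, ¬ (1 / ((k : ℝ) + 1) < |Z ω|) := by
    rw [ae_all_iff]
    intro k
    rw [ae_iff]
    simpa using h (1 / ((k : ℝ) + 1)) (by positivity)
  filter_upwards [h1] with ω hω
  by_contra hne
  obtain ⟨k, hk⟩ := exists_nat_one_div_lt (abs_pos.2 hne)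
  exact hω k hk

/-- Otherwise the tail would not decrease along `ρ ^ k * y`, although it tends to zero at infinity.
-/
theorem exists_tail_lt [IsFiniteMeasure μ] (hZ : AEMeasurable Z μ)
    (hne : ¬ ∀ᵐ ω ∂μ, Z ω = 0) {ρ : ℝ} (hρ : 1 < ρ) :
    ∃ y > 0, μ {ω | ρ * y < |Z ω|} < μ {ω | y < |Z ω|} := by
  by_contra! hcon
  refine hne (ae_eq_zero_of_tail_eq_zero fun y hy => ?_)
  have h1 : ∀ k : ℕ, μ {ω | y < |Z ω|} ≤ μ {ω | ρ ^ k * y < |Z ω|} := by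
    intro k
    induction k with
    | zero => simp
    | succ k ih =>
      refine ih.trans ?_
      have := hcon (ρ ^ k * y) (by positivity)
      rwa [← mul_assoc, ← pow_succ'] at this
  have h2 : Tendsto (fun k : ℕ => μ {ω | ρ ^ k * y < |Z ω|}) atTop (𝓝 0) :=
    (tendsto_tail hZ).comp ((tendsto_pow_atTop_atTop_of_one_lt hρ).atTop_mul_const hy)
  exact le_antisymm (ge_of_tendsto' h2 h1) zero_le

theorem scale_eq_of_tail_eq [IsFiniteMeasure μ] (hZ : AEMeasurable Z μ)
    (hne : ¬ ∀ᵐ ω ∂μ, Z ω = 0) {c d : ℝ} (hc : 0 < c) (hd : 0 < d)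
    (h : ∀ x, μ {ω | x / c < |Z ω|} = μ {ω | x / d < |Z ω|}) : c = d := by
  have key : ∀ {c d : ℝ}, 0 < c → 0 < d →
      (∀ x, μ {ω | x / c < |Z ω|} = μ {ω | x / d < |Z ω|}) → ¬ c < d := by
    intro c d hc hd h hcd
    obtain ⟨y, hy, hlt⟩ := exists_tail_lt hZ hne ((one_lt_div hc).2 hcd)
    have := h (d * y)
    rw [mul_div_cancel_left₀ _ hd.ne', mul_div_right_comm] at this
    exact hlt.ne this
  exact le_antisymm (not_lt.1 (key hd hc fun x => (h x).symm)) (not_lt.1 (key hc hd h))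

theorem tail_add_le {x y : ℝ} :
    μ {ω | x + y < |Y ω|} ≤ μ {ω | x < |Z ω|} + μ {ω | y < |Y ω - Z ω|} := by
  refine (measure_mono fun ω hω => ?_).trans (measure_union_le _ _)
  by_contra hcon
  simp only [Set.mem_union, Set.mem_ofPred_eq, not_or, not_lt] at hω hcon
  have := abs_add_le (Z ω) (Y ω - Z ω)
  rw [add_sub_cancel] at this
  linarith [hcon.1, hcon.2]

theorem tail_sub_le {x y : ℝ} :
    μ {ω | x + y < |Y ω - Z ω|} ≤ μ {ω | x < |Y ω|} + μ {ω | y < |Z ω|} := by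
  refine (measure_mono fun ω hω => ?_).trans (measure_union_le _ _)
  by_contra hcon
  simp only [Set.mem_union, Set.mem_ofPred_eq, not_or, not_lt] at hω hcon
  have := abs_sub (Y ω) (Z ω)
  linarith [hcon.1, hcon.2]

theorem tail_const_mul {c : ℝ} (hc : 0 < c) (x : ℝ) :
    μ {ω | x < |c * Z ω|} = μ {ω | x / c < |Z ω|} := by
  congr 1
  ext ω
  simp only [Set.mem_ofPred_eq]
  rw [abs_mul, abs_of_pos hc, div_lt_iff₀' hc]

theorem tail_congr {Ω' : Type*} [MeasurableSpace Ω'] {ν : Measure Ω'} {W : Ω' → ℝ}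
    (h : IdentDistrib Z W μ ν) (x : ℝ) :
    μ {ω | x < |Z ω|} = ν {ω | x < |W ω|} :=
  h.measure_mem_eq (s := {z | x < |z|}) (measurableSet_lt measurable_const measurable_id.abs)

end Tail

/-! ### Consequences of self-similarity and cyclostationarity for the scaling function. -/

section MarginalLaws

open Filter Topology

variable {Ω : Type*} [MeasurableSpace Ω] {μ : Measure Ω}
  {X : ℕ → Ω → ℝ} {b : ℕ+ → ℝ} {τ : ℕ+}

theorem MarginallySelfSimilar.aemeasurable (h : MarginallySelfSimilar μ X b) (m : ℕ) :
    AEMeasurable (X m) μ := by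
  simpa using (h.2 1 m).aemeasurable_fst

theorem MarginallySelfSimilar.tail_mul (h : MarginallySelfSimilar μ X b) (n : ℕ+) (m : ℕ)
    (x : ℝ) : μ {ω | x < |X (n * m) ω|} = μ {ω | x / b n < |X m ω|} := by
  rw [tail_congr (h.2 n m), tail_const_mul (h.1 n)]

theorem MarginallySelfSimilar.tail (h : MarginallySelfSimilar μ X b) (n : ℕ+)
    (x : ℝ) : μ {ω | x < |X n ω|} = μ {ω | x / b n < |X 1 ω|} := by
  simpa using h.tail_mul n 1 x

theorem MarginallySelfSimilar.map_mul [IsFiniteMeasure μ] (h : MarginallySelfSimilar μ X b)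
    (hne : ¬ ∀ᵐ ω ∂μ, X 1 ω = 0) (m n : ℕ+) : b (m * n) = b m * b n := by
  refine scale_eq_of_tail_eq (h.aemeasurable 1) hne (h.1 _) (mul_pos (h.1 m) (h.1 n)) fun x => ?_
  rw [← h.tail (m * n) x, PNat.mul_coe, h.tail_mul m n x, h.tail n, div_div]

/-- At time zero self-similarity compares `X 0` with `b n` times itself, and a nonzero variable has
only one scale. -/
theorem MarginallySelfSimilar.zero_ae_eq_zero [IsFiniteMeasure μ]
    (h : MarginallySelfSimilar μ X b) {n : ℕ+} (hn : b n ≠ 1) : ∀ᵐ ω ∂μ, X 0 ω = 0 := by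
  by_contra hne
  refine hn (scale_eq_of_tail_eq (h.aemeasurable 0) hne (h.1 _) one_pos fun x => ?_)
  rw [← h.tail_mul n 0 x]
  simp

theorem MarginallyCyclostationaryIncrements.tail
    (h : MarginallyCyclostationaryIncrements μ X τ) (k m : ℕ) (x : ℝ) :
    μ {ω | x < |X (m + k * τ + 1) ω - X (m + k * τ) ω|} = μ {ω | x < |X (m + 1) ω - X m ω|} :=
  (tail_congr (h k m) x).symm

theorem MarginallyCyclostationaryIncrements.tail_le_sum
    (h : MarginallyCyclostationaryIncrements μ X τ) (n : ℕ) (x : ℝ) :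
    μ {ω | x < |X (n + 1) ω - X n ω|} ≤
      ∑ r ∈ Finset.range τ, μ {ω | x < |X (r + 1) ω - X r ω|} := by
  have h1 := h.tail (n / τ) (n % τ) x
  rw [mul_comm, Nat.mod_add_div] at h1
  rw [h1]
  exact Finset.single_le_sum (f := fun r => μ {ω | x < |X (r + 1) ω - X r ω|})
    (fun _ _ => zero_le) (Finset.mem_range.2 (Nat.mod_lt _ τ.pos))

/-- Where the scaling function is large, it varies slowly. -/
theorem exists_forall_adjacent_lt_mul [IsFiniteMeasure μ] (hss : MarginallySelfSimilar μ X b)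
    (hci : MarginallyCyclostationaryIncrements μ X τ) (hne : ¬ ∀ᵐ ω ∂μ, X 1 ω = 0)
    {ρ : ℝ} (hρ : 1 < ρ) :
    ∃ M : ℝ, ∀ m n : ℕ+, ((m : ℕ) = n + 1 ∨ (n : ℕ) = m + 1) → M < b m → b m < ρ * b n := by
  -- Taking `σ` strictly between `1` and `ρ` leaves room: `κ` is chosen so that `y - κ = y * σ / ρ`,
  -- and `κ > 0` because `σ < ρ`. If `b m ≥ ρ * b n`, the level `b m * (y - κ)` is at least `σ * y`
  -- in the scale of `X n`.
  set σ := (1 + ρ) / 2 with hσ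
  obtain ⟨y, hy, hlt⟩ := exists_tail_lt (hss.aemeasurable 1) hne (by rw [hσ]; linarith : 1 < σ)
  set κ := y * (1 - σ / ρ) with hκ
  have hκ0 : 0 < κ := by
    apply mul_pos hy
    rw [sub_pos, div_lt_one (by linarith), hσ]; linarith
  have hG : Tendsto (fun x : ℝ => μ {ω | σ * y < |X 1 ω|} +
      ∑ r ∈ Finset.range τ, μ {ω | x < |X (r + 1) ω - X r ω|}) atTop
      (𝓝 (μ {ω | σ * y < |X 1 ω|} + ∑ r ∈ Finset.range τ, 0)) := by
    refine tendsto_const_nhds.add (tendsto_finsetSum _ fun r _ => tendsto_tail ?_)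
    exact (hss.aemeasurable _).sub (hss.aemeasurable _)
  rw [Finset.sum_const_zero, add_zero] at hG
  obtain ⟨M, hM⟩ := eventually_atTop.1 (hG.eventually_lt_const hlt)
  refine ⟨M / κ, fun m n hmn hMm => ?_⟩
  by_contra! hcon
  have hbm := hss.1 m
  have hbn := hss.1 n
  have hdiff : μ {ω | b m * κ < |X m ω - X n ω|} ≤
      ∑ r ∈ Finset.range τ, μ {ω | b m * κ < |X (r + 1) ω - X r ω|} := by
    rcases hmn with h | h
    · rw [h]; exact hci.tail_le_sum n _
    · simp_rw [abs_sub_comm (X m _)]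
      rw [h]; exact hci.tail_le_sum m _
  have h1 : μ {ω | y < |X 1 ω|} ≤ μ {ω | σ * y < |X 1 ω|} +
      ∑ r ∈ Finset.range τ, μ {ω | b m * κ < |X (r + 1) ω - X r ω|} := by
    calc μ {ω | y < |X 1 ω|} = μ {ω | b m * (y - κ) + b m * κ < |X m ω|} := by
          rw [hss.tail m]
          congr! 4
          field_simp
          ring
      _ ≤ μ {ω | b m * (y - κ) < |X n ω|} + μ {ω | b m * κ < |X m ω - X n ω|} := tail_add_le
      _ ≤ _ := by
          refine add_le_add ?_ hdiff
          rw [hss.tail n]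
          apply tail_anti
          rw [le_div_iff₀ hbn]
          have e : y - κ = y * σ / ρ := by rw [hκ]; ring
          rw [e]
          calc σ * y * b n = y * σ / ρ * (ρ * b n) := by field_simp
            _ ≤ y * σ / ρ * b m := by gcongr
            _ = _ := by ring
  refine absurd h1 (not_le.2 (hM _ ?_))
  rw [div_lt_iff₀ hκ0] at hMm
  exact hMm.le

/-- A residue class containing neighbours at which the scaling function is arbitrarily small has
null increments. -/
theorem increment_ae_eq_zero [IsFiniteMeasure μ] (hss : MarginallySelfSimilar μ X b)
    (hci : MarginallyCyclostationaryIncrements μ X τ) {r : ℕ}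
    (h : ∀ ε > 0, ∃ n : ℕ+, (∃ k : ℕ, (n : ℕ) = r + k * τ) ∧ b n < ε ∧ b (n + 1) < ε) :
    ∀ᵐ ω ∂μ, X (r + 1) ω - X r ω = 0 := by
  refine ae_eq_zero_of_tail_eq_zero fun x hx => ?_
  have hlim : Tendsto (fun t : ℝ => μ {ω | t < |X 1 ω|} + μ {ω | t < |X 1 ω|}) atTop (𝓝 0) := by
    simpa using (tendsto_tail (hss.aemeasurable 1)).add (tendsto_tail (hss.aemeasurable 1))
  refine le_antisymm (ge_of_tendsto hlim ?_) zero_le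
  filter_upwards [eventually_gt_atTop 0] with t ht
  obtain ⟨n, ⟨k, hk⟩, h1, h2⟩ := h (x / 2 / t) (by positivity)
  have key : ∀ m : ℕ+, b m < x / 2 / t → t ≤ x / 2 / b m := fun m hm => by
    rw [le_div_iff₀ (hss.1 m)]
    rw [lt_div_iff₀ ht] at hm
    linarith
  rw [← hci.tail k r x, ← hk, ← add_halves x]
  refine tail_sub_le.trans (add_le_add ?_ ?_)
  · have := hss.tail (n + 1) (x / 2)
    rw [PNat.add_coe, PNat.one_coe] at this
    rw [this]
    exact tail_anti (key _ h2)
  · rw [hss.tail n]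
    exact tail_anti (key _ h1)

end MarginalLaws

/-! ### Completely multiplicative functions. -/

@[elab_as_elim]
theorem pnat_induction_on_primes {P : ℕ+ → Prop} (one : P 1)
    (prime : ∀ p : ℕ+, (p : ℕ).Prime → P p) (mul : ∀ m n, P m → P n → P (m * n)) (n : ℕ+) :
    P n := by
  have key : ∀ n : ℕ, ∀ k : ℕ+, (k : ℕ) = n → P k := by
    intro n
    induction n using induction_on_primes with
    | zero => intro k hk; exact absurd hk k.pos.ne'
    | one =>
      intro k hk
      rwa [PNat.coe_eq_one_iff.1 hk]
    | prime_mul p a hp ih =>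
      intro k hk
      have ha : 0 < a := Nat.pos_of_mul_pos_left (hk ▸ k.pos)
      have hp0 := hp.pos
      lift a to ℕ+ using ha
      lift p to ℕ+ using hp0
      rw [← PNat.mul_coe] at hk
      rw [PNat.eq hk]
      exact mul _ _ (prime p hp) (ih a rfl)
  exact key n n rfl

section Multiplicative

variable {b c : ℕ+ → ℝ}

theorem map_one_of_mul (h0 : ∀ n, 0 < b n) (hb : ∀ m n, b (m * n) = b m * b n) : b 1 = 1 := by
  have h := hb 1 1
  rw [mul_one] at h
  exact (mul_eq_left₀ (h0 1).ne').1 h.symm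

theorem map_pow_of_mul (h0 : ∀ n, 0 < b n) (hb : ∀ m n, b (m * n) = b m * b n) (n : ℕ+) (k : ℕ) :
    b (n ^ k) = b n ^ k := by
  induction k with
  | zero => simpa using map_one_of_mul h0 hb
  | succ k ih => rw [pow_succ, hb, ih, pow_succ]

theorem eq_of_eq_on_primes (hb0 : ∀ n, 0 < b n) (hb : ∀ m n, b (m * n) = b m * b n)
    (hc0 : ∀ n, 0 < c n) (hc : ∀ m n, c (m * n) = c m * c n)
    (h : ∀ p : ℕ+, (p : ℕ).Prime → b p = c p) (n : ℕ+) : b n = c n := by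
  induction n using pnat_induction_on_primes with
  | one => exact (map_one_of_mul hb0 hb).trans (map_one_of_mul hc0 hc).symm
  | prime p hp => exact h p hp
  | mul m n hm hn => rw [hb, hc, hm, hn]

/-- The function `n ↦ |n|_p ^ H`. -/
noncomputable def padicScale (p : ℕ) (H : ℝ) (n : ℕ+) : ℝ :=
  ((padicNorm p ((n : ℕ) : ℚ) : ℚ) : ℝ) ^ H

theorem padicScale_mul {p : ℕ} (hp : p.Prime) (H : ℝ) (m n : ℕ+) :
    padicScale p H (m * n) = padicScale p H m * padicScale p H n := by
  have : Fact p.Prime := ⟨hp⟩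
  unfold padicScale
  rw [PNat.mul_coe, Nat.cast_mul, padicNorm.mul, Rat.cast_mul, Real.mul_rpow]
  · exact_mod_cast padicNorm.nonneg _
  · exact_mod_cast padicNorm.nonneg _

theorem padicScale_pos {p : ℕ} (hp : p.Prime) (H : ℝ) (n : ℕ+) : 0 < padicScale p H n := by
  have : Fact p.Prime := ⟨hp⟩
  refine Real.rpow_pos_of_pos ?_ _
  have h : padicNorm p ((n : ℕ) : ℚ) ≠ 0 := padicNorm.nonzero (by exact_mod_cast n.pos.ne')
  exact_mod_cast lt_of_le_of_ne (padicNorm.nonneg _) h.symm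

theorem padicScale_self {p : ℕ+} (hp : (p : ℕ).Prime) (H : ℝ) :
    padicScale p H p = ((p : ℕ) : ℝ)⁻¹ ^ H := by
  unfold padicScale
  rw [padicNorm.padicNorm_p hp.one_lt]
  push_cast
  rfl

theorem padicScale_eq_one {p : ℕ} (hp : p.Prime) (H : ℝ) {n : ℕ+} (h : ¬ p ∣ n) :
    padicScale p H n = 1 := by
  have : Fact p.Prime := ⟨hp⟩
  unfold padicScale
  rw [(padicNorm.nat_eq_one_iff _).2 h]
  simp

theorem padicScale_self_lt_one {p : ℕ+} (hp : (p : ℕ).Prime) {H : ℝ} (hH : 0 < H) :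
    padicScale p H p < 1 := by
  rw [padicScale_self hp]
  have h1 : (1 : ℝ) < (p : ℕ) := by exact_mod_cast hp.one_lt
  exact Real.rpow_lt_one (by positivity) (inv_lt_one_of_one_lt₀ h1) hH

theorem typeII_iff (hb0 : ∀ n, 0 < b n) (hb : ∀ m n, b (m * n) = b m * b n) :
    TypeII b ↔ ∃ p : ℕ+, (p : ℕ).Prime ∧ b p < 1 ∧
      ∀ q : ℕ+, (q : ℕ).Prime → q ≠ p → b q = 1 := by
  constructor
  · rintro ⟨p, ⟨hp, H, hH, h⟩, -⟩
    have hp0 := hp.pos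
    lift p to ℕ+ using hp0
    refine ⟨p, hp, ?_, fun q hq hqp => ?_⟩
    · rw [h]; exact padicScale_self_lt_one hp hH
    · rw [h]
      refine padicScale_eq_one hp H fun hd => hqp ?_
      exact PNat.eq ((Nat.prime_dvd_prime_iff_eq hp hq).1 hd).symm
  · rintro ⟨p, hp, hp1, hq⟩
    have h1 : (1 : ℝ) < (p : ℕ) := by exact_mod_cast hp.one_lt
    have hlog := Real.log_pos h1
    -- The exponent solves `(p⁻¹) ^ H = b p`.
    refine ⟨p, ⟨hp, -Real.log (b p) / Real.log (p : ℕ), ?_, ?_⟩, ?_⟩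
    · exact div_pos (neg_pos.2 (Real.log_neg (hb0 p) hp1)) hlog
    · refine eq_of_eq_on_primes hb0 hb (padicScale_pos hp _) (padicScale_mul hp _) fun q hqp => ?_
      by_cases hqe : q = p
      · subst hqe
        change b q = padicScale q _ q
        rw [padicScale_self hp, Real.rpow_def_of_pos (by positivity), Real.log_inv]
        rw [show -Real.log (q : ℕ) * (-Real.log (b q) / Real.log (q : ℕ)) = Real.log (b q) by
          field_simp]
        exact (Real.exp_log (hb0 q)).symm
      · rw [hq q hqp hqe]
        refine (padicScale_eq_one hp _ fun hd => ?_).symm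
        exact hqe (PNat.eq ((Nat.prime_dvd_prime_iff_eq hp hqp).1 hd).symm)
    · rintro p' ⟨hp', H, hH, h⟩
      by_contra hne
      have h2 : b p = 1 := by
        rw [h]
        refine padicScale_eq_one hp' H fun hd => hne ?_
        exact (Nat.prime_dvd_prime_iff_eq hp' hp).1 hd
      exact hp1.ne h2

theorem le_pow_of_pow_dvd (hb0 : ∀ n, 0 < b n) (hb : ∀ m n, b (m * n) = b m * b n)
    (hle : ∀ n, b n ≤ 1) {p n : ℕ+} {t : ℕ} (h : (p : ℕ) ^ t ∣ n) : b n ≤ b p ^ t := by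
  rw [← PNat.pow_coe, ← PNat.dvd_iff] at h
  obtain ⟨m, rfl⟩ := h
  rw [hb, map_pow_of_mul hb0 hb]
  exact mul_le_of_le_one_right (pow_nonneg (hb0 p).le t) (hle m)

end Multiplicative

/-! ### Congruences and divisibility of neighbours. -/

section NumberTheory

theorem exists_pos_dvd_modEq {a n : ℕ} (ha : 0 < a) (hn : 0 < n) (h : a.Coprime n) (k : ℕ) :
    ∃ x, 0 < x ∧ a ∣ x ∧ x ≡ k [MOD n] := by
  obtain ⟨x, h1, h2⟩ := Nat.chineseRemainder h 0 k
  refine ⟨x + a * n, by have := Nat.mul_pos ha hn; omega,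
    (Nat.dvd_add_left (dvd_mul_right a n)).2 (Nat.modEq_zero_iff_dvd.1 h1), ?_⟩
  simpa [Nat.ModEq] using h2

/-- Some residue class modulo `τ` contains, for every `t`, a number divisible by `p ^ t` whose
successor is divisible by `q ^ t`. -/
theorem exists_residue_dvd_dvd {p q : ℕ} (hp : p.Prime) (hq : q.Prime) (hpq : p ≠ q)
    {τ : ℕ} (hτ : 0 < τ) :
    ∃ r < τ, ∀ t : ℕ, ∃ n : ℕ, 0 < n ∧ n % τ = r ∧ p ^ t ∣ n ∧ q ^ t ∣ n + 1 := by
  have hex : ∀ t : ℕ, ∃ n : ℕ, 0 < n ∧ p ^ t ∣ n ∧ q ^ t ∣ n + 1 := by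
    intro t
    have hqt : 0 < q ^ t := pow_pos hq.pos t
    obtain ⟨n, h0, h1, h2⟩ := exists_pos_dvd_modEq (pow_pos hp.pos t) hqt
      (((Nat.coprime_primes hp hq).2 hpq).pow t t) (q ^ t - 1)
    refine ⟨n, h0, h1, ?_⟩
    have h3 := h2.add_right 1
    rw [Nat.sub_add_cancel hqt] at h3
    exact Nat.modEq_zero_iff_dvd.1 (h3.trans (by simp [Nat.ModEq]))
  choose n hn0 hnp hnq using hex
  -- Divisibility by higher powers implies it for lower ones, so a class hit for infinitely many `t`
  -- serves every `t`.
  obtain ⟨r, hr⟩ := Finite.exists_infinite_fiber fun t => (⟨n t % τ, Nat.mod_lt _ hτ⟩ : Fin τ)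
  refine ⟨r, r.2, fun t => ?_⟩
  obtain ⟨s, hs, hts⟩ := (Set.infinite_coe_iff.1 hr).exists_gt t
  refine ⟨n s, hn0 s, ?_, (pow_dvd_pow p hts.le).trans (hnp s), (pow_dvd_pow q hts.le).trans (hnq s)⟩
  have := congrArg Fin.val (show _ = r from hs)
  exact this

end NumberTheory

/-! ### The three types of scaling functions. -/

section Classification

variable {Ω : Type*} [MeasurableSpace Ω] {μ : Measure Ω}
  {X : ℕ → Ω → ℝ} {b : ℕ+ → ℝ} {τ : ℕ+}

theorem typeIII_of_one_lt [IsFiniteMeasure μ] (hss : MarginallySelfSimilar μ X b)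
    (hci : MarginallyCyclostationaryIncrements μ X τ) (hne : ¬ ∀ᵐ ω ∂μ, X 1 ω = 0)
    {d : ℕ+} (hd : 1 < b d) : TypeIII b := by
  have hb0 := hss.1
  have hb := hss.map_mul hne
  have hb1 := map_one_of_mul hb0 hb
  set f : ℕ → ℝ := fun n => Real.log (b n.toPNat') with hf
  have hfc : ∀ n : ℕ+, f n = Real.log (b n) := fun n => by simp [hf]
  have hadd : ∀ m n, 0 < m → 0 < n → f (m * n) = f m + f n := by
    intro m n hm hn
    lift m to ℕ+ using hm
    lift n to ℕ+ using hn
    rw [← PNat.mul_coe, hfc, hfc, hfc, hb, Real.log_mul (hb0 m).ne' (hb0 n).ne']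
  have hslow : SlowlyVaryingWhereLarge f := by
    intro ε hε
    obtain ⟨M, hM⟩ := exists_forall_adjacent_lt_mul hss hci hne (Real.one_lt_exp_iff.2 hε)
    refine ⟨Real.log (max M 1), fun m n hm hn hmn hlt => ?_⟩
    lift m to ℕ+ using hm
    lift n to ℕ+ using hn
    rw [hfc] at hlt
    have hMn : M < b n := (le_max_left _ _).trans_lt
      ((Real.log_lt_log_iff (lt_max_of_lt_right one_pos) (hb0 n)).1 hlt)
    have h1 : b n < Real.exp ε * b m := hM n m hmn.symm hMn
    have h2 : b m ≤ Real.exp ε * b n := by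
      by_cases h : M < b m
      · exact (hM m n hmn h).le
      · exact (not_lt.1 h).trans (hMn.le.trans
          (le_mul_of_one_le_left (hb0 n).le (Real.one_lt_exp_iff.2 hε).le))
    have key : ∀ {x y : ℝ}, 0 < x → 0 < y → x ≤ Real.exp ε * y →
        Real.log x ≤ ε + Real.log y := fun hx hy h => by
      have := Real.log_le_log hx h
      rwa [Real.log_mul (Real.exp_pos _).ne' hy.ne', Real.log_exp] at this
    have h3 := key (hb0 n) (hb0 m) h1.le
    have h4 := key (hb0 m) (hb0 n) h2
    rw [hfc, hfc, abs_le]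
    constructor <;> linarith
  have hd2 : 2 ≤ (d : ℕ) := by
    by_contra h
    have h' : d = 1 := PNat.eq (by have := d.pos; rw [PNat.one_coe]; omega)
    rw [h', hb1] at hd
    exact lt_irrefl _ hd
  have hld : 0 < Real.log (d : ℕ) := Real.log_pos (by exact_mod_cast hd2)
  refine ⟨Real.log (b d) / Real.log (d : ℕ), div_pos (Real.log_pos hd) hld, fun n => ?_⟩
  have hn0 : (0 : ℝ) < (n : ℕ) := by exact_mod_cast n.pos
  rw [Real.rpow_def_of_pos hn0, ← Real.exp_log (hb0 n)]
  congr 1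
  by_cases hn : n = 1
  · simp [hn, hb1]
  · have hn2 : 2 ≤ (n : ℕ) := by
      by_contra h
      exact hn (PNat.eq (by have := n.pos; rw [PNat.one_coe]; omega))
    have h := hslow.eq_log hadd hd2 (by rw [hfc]; exact Real.log_pos hd) hn2
    rw [hfc, hfc] at h
    rw [mul_div_assoc', eq_div_iff hld.ne', h, mul_comm]

/-- For distinct `p` and `q`, one builds `N` in a class with null increments, with `p ^ T ∣ N` and
`N + 1 = (m + 1) * (j + 1)`, where `m` is fixed and `j` is divisible by `τ` and `q ^ T`. Then `b N`
is tiny, while `b j` is small and hence `b (j + 1)` is not. This contradicts `b N = b (N + 1)`. -/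
theorem eq_of_lt_one_of_lt_one [IsFiniteMeasure μ] (hss : MarginallySelfSimilar μ X b)
    (hci : MarginallyCyclostationaryIncrements μ X τ) (hne : ¬ ∀ᵐ ω ∂μ, X 1 ω = 0)
    (hle : ∀ n, b n ≤ 1) {p q : ℕ+} (hp : (p : ℕ).Prime) (hq : (q : ℕ).Prime)
    (hbp : b p < 1) (hbq : b q < 1) : p = q := by
  by_contra hpq
  have hb0 := hss.1
  have hb := hss.map_mul hne
  have hτ := τ.pos
  obtain ⟨r, hr, hres⟩ := exists_residue_dvd_dvd hp hq (fun h => hpq (PNat.eq h)) hτ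
  have hmod : ∀ n : ℕ, n % τ = r → n = r + n / τ * τ := fun n h => by
    rw [← h, mul_comm, Nat.mod_add_div]
  have hsmall : ∀ ε > 0, ∃ T : ℕ, b p ^ T < ε ∧ b q ^ T < ε := by
    intro ε hε
    obtain ⟨T₁, h1⟩ := exists_pow_lt_of_lt_one hε hbp
    obtain ⟨T₂, h2⟩ := exists_pow_lt_of_lt_one hε hbq
    exact ⟨max T₁ T₂,
      (pow_le_pow_of_le_one (hb0 p).le hbp.le (le_max_left _ _)).trans_lt h1,
      (pow_le_pow_of_le_one (hb0 q).le hbq.le (le_max_right _ _)).trans_lt h2⟩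
  have hzero : ∀ᵐ ω ∂μ, X (r + 1) ω - X r ω = 0 := by
    refine increment_ae_eq_zero hss hci fun ε hε => ?_
    obtain ⟨T, h1, h2⟩ := hsmall ε hε
    obtain ⟨n, hn0, hnr, hnp, hnq⟩ := hres T
    lift n to ℕ+ using hn0
    exact ⟨n, ⟨_, hmod n hnr⟩, (le_pow_of_pow_dvd hb0 hb hle hnp).trans_lt h1,
      (le_pow_of_pow_dvd hb0 hb hle (by simpa using hnq)).trans_lt h2⟩
  have heq : ∀ n : ℕ+, (n : ℕ) % τ = r → b n = b (n + 1) := by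
    intro n hn
    have h1 : ∀ᵐ ω ∂μ, X (n + 1) ω - X n ω = 0 := by
      refine ae_eq_zero_of_tail_eq_zero fun x hx => ?_
      rw [hmod n hn, hci.tail]
      have h2 : ∀ᵐ ω ∂μ, ¬ x < |X (r + 1) ω - X r ω| := by
        filter_upwards [hzero] with ω hω
        rw [hω, abs_zero]
        exact not_lt.2 hx.le
      simpa [ae_iff] using h2
    refine scale_eq_of_tail_eq (hss.aemeasurable 1) hne (hb0 _) (hb0 _) fun x => ?_
    rw [← hss.tail n, ← hss.tail (n + 1)]
    refine measure_congr ?_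
    filter_upwards [h1] with ω hω
    have h3 : X ((n + 1 : ℕ+) : ℕ) ω = X n ω := by
      rw [PNat.add_coe, PNat.one_coe]; exact sub_eq_zero.1 hω
    exact congrArg (fun z => x < |z|) h3.symm
  -- Otherwise the class of `0` would have null increments, and `X 1 = X 0 = 0` almost surely.
  obtain ⟨δ, hδ0, hδ⟩ : ∃ δ > 0, ∀ n : ℕ+, (τ : ℕ) ∣ n → b n < δ → δ ≤ b (n + 1) := by
    by_contra! hcon
    have h1 : ∀ᵐ ω ∂μ, X (0 + 1) ω - X 0 ω = 0 := by
      refine increment_ae_eq_zero hss hci fun ε hε => ?_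
      obtain ⟨n, ⟨k, hk⟩, hn1, hn2⟩ := hcon ε hε
      exact ⟨n, ⟨k, by rw [hk, zero_add, mul_comm]⟩, hn1, hn2⟩
    refine hne ?_
    filter_upwards [h1, hss.zero_ae_eq_zero hbp.ne] with ω h2 h3
    simpa [h3] using h2
  obtain ⟨m, hm0, hmr, hmp, -⟩ := hres 1
  rw [pow_one] at hmp
  lift m to ℕ+ using hm0
  obtain ⟨T, hTp, hTq⟩ := hsmall (min δ (b (m + 1) * δ)) (lt_min hδ0 (mul_pos (hb0 _) hδ0))
  obtain ⟨n, hn0, hnr, hnp, -⟩ := hres T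
  -- Since `p` may divide `τ`, a solution of `m + k * τ ≡ 0` modulo `p ^ T` is read off from `n`;
  -- the added multiple of `p ^ T` keeps `k` nonnegative.
  obtain ⟨k, hk⟩ : ∃ k, n + (p : ℕ) ^ T * m * τ = m + k * τ := by
    have h1 : (m : ℕ) ≤ n + (p : ℕ) ^ T * m * τ := by
      have h2 : 1 ≤ (p : ℕ) ^ T * τ := Nat.mul_pos (pow_pos p.pos T) hτ
      nlinarith [m.pos]
    have h3 : (m : ℕ) ≡ n + (p : ℕ) ^ T * m * τ [MOD τ] := by
      rw [Nat.ModEq, Nat.add_mul_mod_self_right, hmr, hnr]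
    obtain ⟨k, hk⟩ := (Nat.modEq_iff_dvd' h1).1 h3
    exact ⟨k, by rw [mul_comm k, ← hk]; omega⟩
  -- This is why `m` was taken divisible by `p`: then `p` does not divide `m + 1`.
  have hcop : ((m + 1 : ℕ) * (q : ℕ) ^ T).Coprime ((p : ℕ) ^ T) := by
    refine Nat.Coprime.pow_right T (Nat.Coprime.mul_left ?_ (Nat.Coprime.pow_left T ?_))
    · exact ((Nat.Prime.coprime_iff_not_dvd hp).2 fun h =>
        hp.one_lt.ne' (Nat.dvd_one.1 ((Nat.dvd_add_right hmp).1 h))).symm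
    · exact (Nat.coprime_primes hq hp).2 fun h => hpq (PNat.eq h.symm)
  obtain ⟨y, hy0, ⟨x, rfl⟩, hyk⟩ := exists_pos_dvd_modEq
    (Nat.mul_pos (Nat.succ_pos m) (pow_pos q.pos T)) (pow_pos p.pos T) hcop k
  have hx0 : 0 < x := Nat.pos_of_mul_pos_left hy0
  lift x to ℕ+ using hx0
  set j : ℕ+ := q ^ T * x * τ with hj
  set N : ℕ+ := m + (m + 1) * j with hN
  have hNc : (N : ℕ) = m + ((m + 1 : ℕ) * (q : ℕ) ^ T * x) * τ := by
    rw [hN, hj]; push_cast; ring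
  have hN1 : N + 1 = (m + 1) * (j + 1) := by
    rw [hN]; ring
  have hNr : (N : ℕ) % τ = r := by rw [hNc, Nat.add_mul_mod_self_right, hmr]
  have hNp : (p : ℕ) ^ T ∣ N := by
    rw [← Nat.modEq_zero_iff_dvd, hNc]
    refine ((hyk.mul_right τ).add_left m).trans ?_
    rw [← hk, Nat.modEq_zero_iff_dvd]
    exact dvd_add hnp (by rw [mul_assoc]; exact dvd_mul_right _ _)
  have hjq : b j < δ := by
    refine (le_pow_of_pow_dvd hb0 hb hle (p := q) (t := T) ?_).trans_lt
      (hTq.trans_le (min_le_left _ _))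
    rw [hj]; push_cast; rw [mul_assoc]; exact dvd_mul_right _ _
  have h1 : b (m + 1) * δ ≤ b (N + 1) := by
    rw [hN1, hb]
    exact mul_le_mul_of_nonneg_left (hδ j (by rw [hj, PNat.mul_coe]; exact dvd_mul_left _ _) hjq)
      (hb0 _).le
  have h2 := (le_pow_of_pow_dvd hb0 hb hle hNp).trans_lt (hTp.trans_le (min_le_right _ _))
  rw [heq N hNr] at h2
  linarith

theorem scaling_classification [IsFiniteMeasure μ] (hss : MarginallySelfSimilar μ X b)
    (hci : MarginallyCyclostationaryIncrements μ X τ) (hne : ¬ ∀ᵐ ω ∂μ, X 1 ω = 0) :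
    TypeI b ∨ TypeII b ∨ TypeIII b := by
  have hb0 := hss.1
  have hb := hss.map_mul hne
  by_cases hlarge : ∃ d, 1 < b d
  · exact Or.inr (Or.inr (typeIII_of_one_lt hss hci hne hlarge.choose_spec))
  push Not at hlarge
  by_cases hprime : ∃ p : ℕ+, (p : ℕ).Prime ∧ b p < 1
  · obtain ⟨p, hp, hbp⟩ := hprime
    refine Or.inr (Or.inl ((typeII_iff hb0 hb).2 ⟨p, hp, hbp, fun q hq hqp => ?_⟩))
    by_contra hbq
    exact hqp (eq_of_lt_one_of_lt_one hss hci hne hlarge hq hp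
      (lt_of_le_of_ne (hlarge q) hbq) hbp)
  · push Not at hprime
    refine Or.inl (eq_of_eq_on_primes hb0 hb (c := fun _ => 1) (fun _ => one_pos)
      (fun _ _ => (one_mul _).symm) fun p hp => le_antisymm (hlarge p) (hprime p hp))

end Classification

/-! ### Equality in law by measure preserving maps. -/

section Transport

variable {Ω : Type*} [MeasurableSpace Ω] {μ : Measure Ω}

theorem identDistrib_of_ae_eq_comp {E : Type*} [MeasurableSpace E] {T : Ω → Ω}
    (hT : MeasurePreserving T μ μ) {F G : Ω → E} (hF : Measurable F)
    (h : ∀ᵐ ω ∂μ, G ω = F (T ω)) : IdentDistrib G F μ μ := by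
  have h' : G =ᵐ[μ] F ∘ T := h
  refine ⟨(hF.comp hT.measurable).aemeasurable.congr h'.symm, hF.aemeasurable, ?_⟩
  rw [Measure.map_congr h', ← Measure.map_map hF hT.measurable, hT.map_eq]

/-- Changing the variables by a measure preserving map turns an almost surely constant function
into an almost surely constant one, with the same constant. -/
theorem ae_eq_comp_of_ae_const {T : Ω → Ω} (hT : MeasurePreserving T μ μ) {F : Ω → ℝ} {a : ℝ}
    (h : ∀ᵐ ω ∂μ, F ω = a) : ∀ᵐ ω ∂μ, F (T ω) = F ω := by
  filter_upwards [h, hT.quasiMeasurePreserving.ae h] with ω h1 h2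
  rw [h1, h2]

theorem selfSimilar_of_measurePreserving {X : ℕ → Ω → ℝ} {b : ℕ+ → ℝ}
    (hX : ∀ m, Measurable (X m)) (hb : ∀ n, 0 < b n)
    (h : ∀ n : ℕ+, ∃ T : Ω → Ω, MeasurePreserving T μ μ ∧
      ∀ m ω, X ((n : ℕ) * m) ω = b n * X m (T ω)) : SelfSimilar μ X b := by
  refine ⟨hb, fun n => ?_⟩
  obtain ⟨T, hT, hTX⟩ := h n
  exact identDistrib_of_ae_eq_comp hT
    (measurable_pi_lambda _ fun m => measurable_const.mul (hX m))
    (Filter.Eventually.of_forall fun ω => funext fun m => hTX m ω)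

theorem stationaryIncrements_of_measurePreserving {X : ℕ → Ω → ℝ}
    (hX : ∀ m, Measurable (X m))
    (h : ∀ k : ℕ, ∃ T : Ω → Ω, MeasurePreserving T μ μ ∧
      ∀ᵐ ω ∂μ, ∀ m, X (m + k + 1) ω - X (m + k) ω = X (m + 1) (T ω) - X m (T ω)) :
    StationaryIncrements μ X := by
  intro k
  obtain ⟨T, hT, hTX⟩ := h k
  refine (identDistrib_of_ae_eq_comp hT
    (measurable_pi_lambda _ fun m => (hX (m + 1)).sub (hX m)) ?_).symm
  filter_upwards [hTX] with ω hω
  exact funext hω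

end Transport

/-! ### Symmetries of product measures, and the fair coin. -/

section Product

variable {ι κ A : Type*} [MeasurableSpace A] (ν : Measure A) [IsProbabilityMeasure ν]

/-- A subfamily of independent, identically distributed coordinates has the same joint law as the
full family. Injectivity suffices, which matters for multiplication by `p`, where `σ` is not onto.
-/
theorem measurePreserving_reindex {σ : κ → ι} (hσ : σ.Injective) :
    MeasurePreserving (fun (ω : ι → A) i => ω (σ i))
      (Measure.infinitePi fun _ => ν) (Measure.infinitePi fun _ => ν) := by
  refine ⟨by fun_prop, ?_⟩
  have h := (iIndepFun_infinitePi (P := fun _ : ι => ν) (X := fun _ x => x)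
    (fun _ => measurable_id)).precomp hσ
  rw [iIndepFun_iff_map_fun_eq_infinitePi_map (by fun_prop)] at h
  rw [h]
  congr 1
  ext1 i
  exact Measure.infinitePi_map_eval (fun _ : ι => ν) (σ i)

theorem measurePreserving_coordinatewise {f : ι → A → A} (hf : ∀ i, MeasurePreserving (f i) ν ν) :
    MeasurePreserving (fun (ω : ι → A) i => f i (ω i))
      (Measure.infinitePi fun _ => ν) (Measure.infinitePi fun _ => ν) := by
  refine ⟨measurable_pi_lambda _ fun i => (hf i).measurable.comp (measurable_pi_apply i), ?_⟩
  rw [Measure.infinitePi_map_pi _ fun i => (hf i).measurable]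
  congr 1
  ext1 i
  exact (hf i).map_eq

end Product

/-- The law of a fair coin. -/
noncomputable def coin : Measure Bool := (2⁻¹ : ENNReal) • (Measure.dirac true + Measure.dirac false)

instance : IsProbabilityMeasure coin := ⟨by
  simp [coin, ENNReal.inv_two_add_inv_two]⟩

theorem measurePreserving_not_coin : MeasurePreserving not coin coin := by
  refine ⟨measurable_from_top, ?_⟩
  rw [coin, Measure.map_smul, Measure.map_add _ _ measurable_from_top,
    Measure.map_dirac' measurable_from_top, Measure.map_dirac' measurable_from_top, add_comm]
  rfl

/-- The numerical outcome of a coin toss. -/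
def coinValue (x : Bool) : ℝ := if x then 1 else 0

theorem coinValue_not_ne (x : Bool) : coinValue (!x) ≠ coinValue x := by
  cases x <;> simp [coinValue]

theorem abs_coinValue_sub_le (x y : Bool) : |coinValue x - coinValue y| ≤ 1 := by
  cases x <;> cases y <;> simp [coinValue]

/-- A process constant in time has zero increments, so any nondegenerate variable will do. -/
theorem exists_process_typeI {b : ℕ+ → ℝ} (hb : TypeI b) :
    ∃ (Ω : Type) (_ : MeasurableSpace Ω) (μ : Measure Ω) (_ : IsProbabilityMeasure μ)
      (X : ℕ → Ω → ℝ), (∀ m : ℕ, Measurable (X m)) ∧ SelfSimilar μ X b ∧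
        StationaryIncrements μ X ∧ ∀ c : ℝ, ¬ ∀ᵐ ω ∂μ, X 1 ω = c := by
  have hX : ∀ _ : ℕ, Measurable coinValue := fun _ => measurable_from_top
  refine ⟨Bool, inferInstance, coin, inferInstance, fun _ => coinValue, hX, ?_, ?_, ?_⟩
  · refine selfSimilar_of_measurePreserving hX (fun n => by rw [hb n]; exact one_pos) fun n => ?_
    exact ⟨id, MeasurePreserving.id _, fun m ω => by rw [hb n, one_mul]; rfl⟩
  · refine stationaryIncrements_of_measurePreserving hX fun k => ?_
    exact ⟨id, MeasurePreserving.id _, Filter.Eventually.of_forall fun ω m => rfl⟩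
  · intro c hc
    obtain ⟨ω, hω⟩ := (ae_eq_comp_of_ae_const measurePreserving_not_coin hc).exists
    exact coinValue_not_ne ω hω

/-! ### The process for type II. -/

section Padic

variable {p : ℕ} {c : ℝ}

/-- Outcomes of independent coin tosses indexed by the residue classes modulo powers of `p`. -/
abbrev PadicCoins (p : ℕ) : Type := (Σ k : ℕ, ZMod (p ^ k)) → Bool

/-- The law of independent fair coin tosses. -/
noncomputable def padicCoinsLaw (p : ℕ) : Measure (PadicCoins p) := Measure.infinitePi fun _ => coin

instance : IsProbabilityMeasure (padicCoinsLaw p) := by unfold padicCoinsLaw; infer_instance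

/-- The contribution of the residue classes modulo `p ^ k` to `padicProcess`. -/
noncomputable def padicTerm (c : ℝ) (m : ℕ) (ω : PadicCoins p) (k : ℕ) : ℝ :=
  c ^ k * (coinValue (ω ⟨k, m⟩) - coinValue (ω ⟨k, 0⟩))

/-- A process with stationary increments that is contracted by `c` when time is multiplied
by `p`. -/
noncomputable def padicProcess (p : ℕ) (c : ℝ) (m : ℕ) (ω : PadicCoins p) : ℝ :=
  ∑' k, padicTerm c m ω k

theorem summable_padicTerm (hc0 : 0 < c) (hc1 : c < 1) (m : ℕ) (ω : PadicCoins p) :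
    Summable (padicTerm c m ω) := by
  refine Summable.of_norm_bounded (summable_geometric_of_lt_one hc0.le hc1) fun k => ?_
  rw [padicTerm, Real.norm_eq_abs, abs_mul, abs_of_pos (pow_pos hc0 k)]
  exact mul_le_of_le_one_right (pow_pos hc0 k).le (abs_coinValue_sub_le _ _)

theorem measurable_padicProcess (m : ℕ) : Measurable (padicProcess p c m) := by
  have hv : Measurable coinValue := measurable_from_top
  refine Measurable.tsum fun k => ?_
  exact measurable_const.mul
    ((hv.comp (measurable_pi_apply _)).sub (hv.comp (measurable_pi_apply _)))

theorem padicProcess_shift (hc0 : 0 < c) (hc1 : c < 1) (l m : ℕ) (ω : PadicCoins p) :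
    padicProcess p c (m + l + 1) ω - padicProcess p c (m + l) ω =
      padicProcess p c (m + 1) (fun i => ω ⟨i.1, i.2 + l⟩) -
        padicProcess p c m (fun i => ω ⟨i.1, i.2 + l⟩) := by
  simp only [padicProcess]
  rw [← (summable_padicTerm hc0 hc1 _ _).tsum_sub (summable_padicTerm hc0 hc1 _ _),
    ← (summable_padicTerm hc0 hc1 _ _).tsum_sub (summable_padicTerm hc0 hc1 _ _)]
  refine tsum_congr fun k => ?_
  simp only [padicTerm]
  push_cast
  rw [show (m : ZMod (p ^ k)) + 1 + l = m + l + 1 by ring]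
  ring

/-- The identity holds for every `n`; coprimality to `p` is what makes the reindexing injective,
hence measure preserving. -/
theorem padicProcess_mul_coprime {n : ℕ} (m : ℕ) (ω : PadicCoins p) :
    padicProcess p c (n * m) ω = padicProcess p c m (fun i => ω ⟨i.1, n * i.2⟩) := by
  simp only [padicProcess, padicTerm, Nat.cast_mul, mul_zero]

/-- Multiplication by `p`, from residues modulo `p ^ k` to residues modulo `p ^ (k + 1)`. -/
def mulPrime (p k : ℕ) (r : ZMod (p ^ k)) : ZMod (p ^ (k + 1)) := ((p * r.val : ℕ) : ZMod _)

theorem mulPrime_natCast (k m : ℕ) : mulPrime p k m = ((p * m : ℕ) : ZMod _) := by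
  rw [mulPrime, ZMod.natCast_eq_natCast_iff, ZMod.val_natCast, Nat.ModEq, pow_succ',
    Nat.mul_mod_mul_left, Nat.mul_mod_mul_left, Nat.mod_mod]

theorem mulPrime_injective (hp : 0 < p) (k : ℕ) : (mulPrime p k).Injective := by
  have : NeZero (p ^ k) := ⟨(pow_pos hp k).ne'⟩
  intro r s h
  have hlt : ∀ r : ZMod (p ^ k), p * r.val < p ^ (k + 1) := fun r => by
    rw [pow_succ']; exact Nat.mul_lt_mul_of_pos_left (ZMod.val_lt r) hp
  rw [mulPrime, mulPrime, ZMod.natCast_eq_natCast_iff, Nat.ModEq, Nat.mod_eq_of_lt (hlt r),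
    Nat.mod_eq_of_lt (hlt s)] at h
  exact ZMod.val_injective _ (Nat.eq_of_mul_eq_mul_left hp h)

/-- The term `k = 0` vanishes because there is one residue modulo `1`; the others move down one
level, which releases a factor `c`. -/
theorem padicProcess_mul_prime (hc0 : 0 < c) (hc1 : c < 1) (m : ℕ) (ω : PadicCoins p) :
    padicProcess p c (p * m) ω =
      c * padicProcess p c m (fun i => ω ⟨i.1 + 1, mulPrime p i.1 i.2⟩) := by
  simp only [padicProcess]
  rw [(summable_padicTerm hc0 hc1 _ _).tsum_eq_zero_add, ← tsum_mul_left]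
  have h0 : padicTerm c (p * m) ω 0 = 0 := by
    have : ((p * m : ℕ) : ZMod (p ^ 0)) = 0 := (ZMod.natCast_eq_zero_iff _ _).2 (by simp)
    rw [padicTerm, this, sub_self, mul_zero]
  rw [h0, zero_add]
  refine tsum_congr fun k => ?_
  have hz := mulPrime_natCast (p := p) k 0
  simp only [Nat.cast_zero, mul_zero] at hz
  simp only [padicTerm, mulPrime_natCast, hz]
  ring

theorem exists_process_typeII {b : ℕ+ → ℝ} (hb : TypeII b) :
    ∃ (Ω : Type) (_ : MeasurableSpace Ω) (μ : Measure Ω) (_ : IsProbabilityMeasure μ)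
      (X : ℕ → Ω → ℝ), (∀ m : ℕ, Measurable (X m)) ∧ SelfSimilar μ X b ∧
        StationaryIncrements μ X ∧ ∀ c : ℝ, ¬ ∀ᵐ ω ∂μ, X 1 ω = c := by
  obtain ⟨p, ⟨hp, H, hH, hbH⟩, -⟩ := hb
  have hp0 := hp.pos
  lift p to ℕ+ using hp0
  obtain rfl : b = padicScale p H := funext hbH
  set c := padicScale p H p with hc
  have hc0 : 0 < c := padicScale_pos hp H p
  have hc1 : c < 1 := padicScale_self_lt_one hp hH
  refine ⟨PadicCoins p, inferInstance, padicCoinsLaw p, inferInstance, padicProcess p c,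
    measurable_padicProcess, ?_, ?_, ?_⟩
  · refine selfSimilar_of_measurePreserving measurable_padicProcess (padicScale_pos hp H)
      fun n => ?_
    induction n using pnat_induction_on_primes with
    | one =>
      refine ⟨id, MeasurePreserving.id _, fun m ω => ?_⟩
      rw [padicScale_eq_one hp H (by simpa using hp.one_lt.ne'), one_mul, PNat.one_coe, one_mul]
      rfl
    | prime q hq =>
      by_cases hqp : q = p
      · subst hqp
        refine ⟨_, measurePreserving_reindex coin (σ := fun i => ⟨i.1 + 1, mulPrime q i.1 i.2⟩) ?_,
          fun m ω => padicProcess_mul_prime hc0 hc1 m ω⟩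
        rintro ⟨k, r⟩ ⟨l, s⟩ h
        obtain ⟨h1, h2⟩ := Sigma.mk.inj h
        obtain rfl : k = l := Nat.succ_injective h1
        exact congrArg (Sigma.mk k) (mulPrime_injective q.pos k (eq_of_heq h2))
      · have hcop : (q : ℕ).Coprime p :=
          (Nat.coprime_primes hq hp).2 fun h => hqp (PNat.eq h)
        have h1 : padicScale p H q = 1 := padicScale_eq_one hp H fun h =>
          hqp (PNat.eq ((Nat.prime_dvd_prime_iff_eq hp hq).1 h).symm)
        refine ⟨_, measurePreserving_reindex coin
          (σ := fun i : Σ k : ℕ, ZMod ((p : ℕ) ^ k) => ⟨i.1, (q : ℕ) * i.2⟩) ?_,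
          fun m ω => by rw [h1, one_mul]; exact padicProcess_mul_coprime m ω⟩
        rintro ⟨k, r⟩ ⟨l, s⟩ h
        obtain ⟨h1, h2⟩ := Sigma.mk.inj h
        obtain rfl : k = l := h1
        exact congrArg (Sigma.mk k)
          (((ZMod.isUnit_iff_coprime _ _).2 (hcop.pow_right k)).mul_left_cancel (eq_of_heq h2))
    | mul m n hm hn =>
      obtain ⟨S, hS, hSX⟩ := hm
      obtain ⟨T, hT, hTX⟩ := hn
      refine ⟨T ∘ S, hT.comp hS, fun k ω => ?_⟩
      rw [PNat.mul_coe, mul_assoc, hSX, hTX, padicScale_mul hp, mul_assoc]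
      rfl
  · refine stationaryIncrements_of_measurePreserving measurable_padicProcess fun l => ?_
    refine ⟨_, measurePreserving_reindex coin
      (σ := fun i : Σ k : ℕ, ZMod ((p : ℕ) ^ k) => ⟨i.1, i.2 + l⟩) ?_,
      Filter.Eventually.of_forall fun ω m => padicProcess_shift hc0 hc1 l m ω⟩
    rintro ⟨k, r⟩ ⟨j, s⟩ h
    obtain ⟨h1, h2⟩ := Sigma.mk.inj h
    obtain rfl : k = j := h1
    exact congrArg (Sigma.mk k) (add_right_cancel (eq_of_heq h2))
  · intro a ha
    -- Flipping this one coin preserves the law but changes exactly one term of `X 1`, so `X 1`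
    -- cannot be almost surely constant.
    set i₀ : Σ k : ℕ, ZMod ((p : ℕ) ^ k) := ⟨1, 1⟩ with hi₀
    have hflip := measurePreserving_coordinatewise coin
      (f := fun i : Σ k : ℕ, ZMod ((p : ℕ) ^ k) => if i = i₀ then not else id) fun i => by
        split_ifs
        · exact measurePreserving_not_coin
        · exact MeasurePreserving.id _
    obtain ⟨ω, hω⟩ := (ae_eq_comp_of_ae_const (μ := padicCoinsLaw p) hflip ha).exists
    have : Fact (1 < (p : ℕ) ^ 1) := ⟨by rw [pow_one]; exact hp.one_lt⟩
    refine coinValue_not_ne (ω i₀) ?_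
    simp only [padicProcess] at hω
    rw [← sub_eq_zero, ← (summable_padicTerm hc0 hc1 _ _).tsum_sub
      (summable_padicTerm hc0 hc1 _ _), tsum_eq_single 1] at hω
    · have h10 : (⟨1, 0⟩ : Σ k : ℕ, ZMod ((p : ℕ) ^ k)) ≠ i₀ := by
        rw [hi₀]
        intro h
        exact zero_ne_one (eq_of_heq (Sigma.mk.inj h).2)
      simp only [padicTerm, Nat.cast_one, h10, if_false, if_true, id, ← hi₀, ← mul_sub,
        sub_sub_sub_cancel_right] at hω
      exact sub_eq_zero.1 ((mul_eq_zero.1 hω).resolve_left (pow_pos hc0 1).ne')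
    · intro k hk
      have hk' : ∀ r, (⟨k, r⟩ : Σ k : ℕ, ZMod ((p : ℕ) ^ k)) ≠ i₀ := fun r h =>
        hk (Sigma.mk.inj h).1
      simp only [padicTerm, hk', if_false, id, sub_self]

end Padic

/-! ### The probability space for type III. -/

section Phases

instance : IsProbabilityMeasure (volume : Measure UnitAddCircle) := ⟨UnitAddCircle.measure_univ⟩

/-- A random scale, given by its logarithm modulo one, together with independent phases. -/
abbrev ScaledPhases : Type := UnitAddCircle × (ℤ → UnitAddCircle)

/-- The law under which the scale and all the phases are independent and uniform. -/
noncomputable def scaledPhasesLaw : Measure ScaledPhases :=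
  (volume : Measure UnitAddCircle).prod (Measure.infinitePi fun _ => volume)

instance : IsProbabilityMeasure scaledPhasesLaw := by unfold scaledPhasesLaw; infer_instance

theorem measurePreserving_phase (k : ℤ) :
    MeasurePreserving (fun ω : ScaledPhases => ω.2 k) scaledPhasesLaw volume :=
  (measurePreserving_eval_infinitePi (fun _ : ℤ => (volume : Measure UnitAddCircle)) k).comp
    measurePreserving_snd

/-- Conditionally on the scale, the phases undergo fixed rotations, which preserve the uniform law.
-/
theorem measurePreserving_translate {h : ℤ → UnitAddCircle → UnitAddCircle}
    (hh : ∀ k, Measurable (h k)) :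
    MeasurePreserving (fun ω : ScaledPhases => (ω.1, fun k => ω.2 k + h k ω.1))
      scaledPhasesLaw scaledPhasesLaw := by
  refine (MeasurePreserving.id volume).skew_product
    (g := fun u (θ : ℤ → UnitAddCircle) k => θ k + h k u) ?_ (Filter.Eventually.of_forall fun u => ?_)
  · refine measurable_pi_lambda _ fun k => ?_
    exact ((measurable_pi_apply k).comp measurable_snd).add ((hh k).comp measurable_fst)
  · exact (measurePreserving_coordinatewise volume
      fun k => measurePreserving_add_right volume (h k u)).map_eq

theorem measurePreserving_rescale (a : UnitAddCircle) {j : UnitAddCircle → ℤ}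
    (hj : Measurable j) :
    MeasurePreserving (fun ω : ScaledPhases => (ω.1 - a, fun k => ω.2 (k + j ω.1)))
      scaledPhasesLaw scaledPhasesLaw := by
  refine (measurePreserving_sub_right volume a).skew_product
    (g := fun u (θ : ℤ → UnitAddCircle) k => θ (k + j u)) ?_ (Filter.Eventually.of_forall fun u => ?_)
  · refine measurable_pi_lambda _ fun k => ?_
    have h1 : Measurable fun q : ℤ × (ℤ → UnitAddCircle) => q.2 q.1 :=
      measurable_from_prod_countable_right fun i => measurable_pi_apply i
    exact h1.comp ((measurable_const.add (hj.comp measurable_fst)).prodMk measurable_snd)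
  · exact (measurePreserving_reindex volume (add_left_injective (j u))).map_eq

end Phases

/-! ### The indicator of an arc and its discontinuities. -/

section Window

/-- The representative in `[0, 1)` of a point of the circle. -/
noncomputable def representative (u : UnitAddCircle) : ℝ := AddCircle.equivIco 1 0 u

theorem measurable_representative : Measurable representative :=
  measurable_subtype_coe.comp (AddCircle.measurableEquivIco 1 0).measurable

theorem representative_nonneg (u : UnitAddCircle) : 0 ≤ representative u :=
  (AddCircle.equivIco 1 0 u).2.1

theorem representative_lt_one (u : UnitAddCircle) : representative u < 1 := by
  exact ((AddCircle.equivIco (1 : ℝ) 0 u).2.2).trans_eq (zero_add 1)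

theorem coe_representative (u : UnitAddCircle) : (representative u : UnitAddCircle) = u :=
  (AddCircle.equivIco (1 : ℝ) 0).symm_apply_apply u

/-- The indicator function of an arc of length one half. -/
noncomputable def arc (x : UnitAddCircle) : ℝ := Set.indicator (Metric.closedBall 0 (1 / 4)) 1 x

theorem measurable_arc : Measurable arc :=
  measurable_one.indicator measurableSet_closedBall

theorem arc_eq_one {x : UnitAddCircle} (h : ‖x‖ ≤ 1 / 4) : arc x = 1 :=
  Set.indicator_of_mem (mem_closedBall_zero_iff.2 h) _

theorem arc_eq_zero {x : UnitAddCircle} (h : 1 / 4 < ‖x‖) : arc x = 0 :=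
  Set.indicator_of_notMem (fun h' => not_le.2 h (mem_closedBall_zero_iff.1 h')) _

theorem abs_arc_sub_le (x y : UnitAddCircle) : |arc x - arc y| ≤ 1 := by
  rcases le_or_gt ‖x‖ (1 / 4) with hx | hx <;> rcases le_or_gt ‖y‖ (1 / 4) with hy | hy <;>
    simp [arc_eq_one, arc_eq_zero, hx, hy, - one_div]

theorem norm_coe_le (t : ℝ) : ‖(t : UnitAddCircle)‖ ≤ |t| := by
  rw [UnitAddCircle.norm_eq]
  simpa using round_le t 0

theorem norm_coe_eq {t : ℝ} (h : |t| ≤ 1 / 2) : ‖(t : UnitAddCircle)‖ = |t| := by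
  rw [AddCircle.norm_coe_eq_abs_iff _ one_ne_zero]
  simpa using h

/-- The points within distance `r` of the ends of the arc. -/
def arcEnds (r : ℝ) : Set UnitAddCircle :=
  Metric.closedBall 0 (1 / 4 + r) \ Metric.closedBall 0 (1 / 4 - r)

theorem measurableSet_arcEnds (r : ℝ) : MeasurableSet (arcEnds r) :=
  measurableSet_closedBall.diff measurableSet_closedBall

theorem volume_arcEnds_le {r : ℝ} (hr : 0 ≤ r) : volume (arcEnds r) ≤ ENNReal.ofReal (4 * r) := by
  rw [arcEnds, measure_sdiff (Metric.closedBall_subset_closedBall (by linarith))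
    measurableSet_closedBall.nullMeasurableSet (measure_ne_top _ _), AddCircle.volume_closedBall,
    AddCircle.volume_closedBall, min_eq_right (by linarith : 2 * (1 / 4 - r) ≤ 1),
    tsub_le_iff_right]
  calc _ ≤ ENNReal.ofReal (4 * r + 2 * (1 / 4 - r)) :=
        ENNReal.ofReal_le_ofReal ((min_le_right _ _).trans_eq (by ring))
    _ ≤ _ := ENNReal.ofReal_add_le

theorem arc_add_eq {x : UnitAddCircle} {t r : ℝ} (ht : |t| < r) (hx : x ∉ arcEnds r) :
    arc (t + x) = arc x := by
  have h1 : ‖(t : UnitAddCircle)‖ < r := (norm_coe_le t).trans_lt ht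
  have h2 := norm_add_le (t : UnitAddCircle) x
  have h3 : ‖x‖ ≤ ‖(t : UnitAddCircle) + x‖ + ‖(t : UnitAddCircle)‖ := by
    simpa using norm_sub_le ((t : UnitAddCircle) + x) t
  have h4 : ‖x‖ ≤ 1 / 4 + r → ‖x‖ ≤ 1 / 4 - r := by
    simpa only [arcEnds, Set.mem_sdiff, mem_closedBall_zero_iff, not_and, not_not] using hx
  rcases le_or_gt ‖x‖ (1 / 4 + r) with h | h
  · have := h4 h
    rw [arc_eq_one (by linarith), arc_eq_one (by linarith)]
  · rw [arc_eq_zero (by linarith), arc_eq_zero (by linarith)]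

/-- With `x` near `3/16`, the step `s` carries `x` out of the arc and carries the antipode of `x`
into it, so the expression equals `2`. -/
theorem arc_second_difference_ne_zero {x : UnitAddCircle}
    (hx : x ∈ Metric.closedBall ((3 / 16 : ℝ) : UnitAddCircle) (1 / 32)) {s : ℝ}
    (hs1 : 1 / 8 < s) (hs2 : s ≤ 1 / 4) :
    (arc (s + (x + (1 / 2 : ℝ))) - arc (x + (1 / 2 : ℝ))) - (arc (s + x) - arc x) ≠ 0 := by
  obtain ⟨t, ht1, ht2, rfl⟩ : ∃ t : ℝ, 5 / 32 ≤ t ∧ t ≤ 7 / 32 ∧ (t : UnitAddCircle) = x := by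
    obtain ⟨y, rfl⟩ := QuotientAddGroup.mk_surjective x
    rw [mem_closedBall_iff_norm] at hx
    change ‖((y - 3 / 16 : ℝ) : UnitAddCircle)‖ ≤ _ at hx
    rw [UnitAddCircle.norm_eq, abs_le] at hx
    refine ⟨y - round (y - 3 / 16), by linarith [hx.1], by linarith [hx.2], ?_⟩
    have h := AddCircle.coe_period (1 : ℝ)
    rw [AddCircle.coe_sub, sub_eq_self, ← zsmul_one, AddCircle.coe_zsmul, h, smul_zero]
  have hper : ((1 / 2 : ℝ) : UnitAddCircle) = ((-1 / 2 : ℝ) : UnitAddCircle) := by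
    have h := AddCircle.coe_period (1 : ℝ)
    rw [← sub_eq_zero, ← AddCircle.coe_sub]
    norm_num [h]
  rw [hper, ← AddCircle.coe_add, ← AddCircle.coe_add, ← AddCircle.coe_add]
  have e1 : arc ((s + (t + -1 / 2) : ℝ) : UnitAddCircle) = 1 :=
    arc_eq_one ((norm_coe_le _).trans (abs_le.2 ⟨by linarith, by linarith⟩))
  have e2 : arc ((t + -1 / 2 : ℝ) : UnitAddCircle) = 0 := by
    refine arc_eq_zero ?_
    rw [norm_coe_eq (abs_le.2 ⟨by linarith, by linarith⟩)]
    exact lt_abs.2 (Or.inr (by linarith))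
  have e3 : arc ((s + t : ℝ) : UnitAddCircle) = 0 := by
    refine arc_eq_zero ?_
    rw [norm_coe_eq (abs_le.2 ⟨by linarith, by linarith⟩)]
    exact lt_abs.2 (Or.inl (by linarith))
  have e4 : arc (t : UnitAddCircle) = 1 :=
    arc_eq_one ((norm_coe_le _).trans (abs_le.2 ⟨by linarith, by linarith⟩))
  rw [e1, e2, e3, e4]
  norm_num

end Window

/-! ### The process for type III. -/

section Archimedean

variable {H : ℝ}

/-- The `k`-th frequency attached to the scale parameter `u`. -/
noncomputable def frequency (k : ℤ) (u : UnitAddCircle) : ℝ := (2 : ℝ) ^ (-(k + representative u))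

theorem frequency_pos (k : ℤ) (u : UnitAddCircle) : 0 < frequency k u :=
  Real.rpow_pos_of_pos two_pos _

theorem measurable_frequency (k : ℤ) : Measurable (frequency k) :=
  measurable_const.pow (measurable_const.add measurable_representative).neg

theorem frequency_le (k : ℕ) (u : UnitAddCircle) : frequency k u ≤ (1 / 2) ^ k := by
  rw [one_div, inv_pow, ← Real.rpow_natCast, ← Real.rpow_neg zero_le_two, frequency]
  refine Real.rpow_le_rpow_of_exponent_le one_le_two ?_
  have := representative_nonneg u
  push_cast
  linarith

theorem frequency_rpow_neg_le (hH : 0 < H) (k : ℕ) (u : UnitAddCircle) :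
    frequency (-(k + 1)) u ^ (-H) ≤ ((2 : ℝ) ^ (-H)) ^ k := by
  rw [frequency, ← Real.rpow_natCast, ← Real.rpow_mul zero_le_two, ← Real.rpow_mul zero_le_two]
  refine Real.rpow_le_rpow_of_exponent_le one_le_two ?_
  have := representative_lt_one u
  push_cast
  nlinarith

/-- The contribution of the `k`-th frequency to `steppedProcess`. -/
noncomputable def steppedTerm (H : ℝ) (m : ℕ) (ω : ScaledPhases) (k : ℤ) : ℝ :=
  frequency k ω.1 ^ (-H) *
    (arc (((m * frequency k ω.1 : ℝ) : UnitAddCircle) + ω.2 k) - arc (ω.2 k))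

/-- A random superposition of step functions, over all frequencies, with stationary increments
and self-similarity exponent `H`. -/
noncomputable def steppedProcess (H : ℝ) (m : ℕ) (ω : ScaledPhases) : ℝ :=
  ∑' k, steppedTerm H m ω k

theorem measurable_steppedProcess (m : ℕ) : Measurable (steppedProcess H m) := by
  refine Measurable.tsum fun k => ?_
  have h1 : Measurable fun ω : ScaledPhases => frequency k ω.1 :=
    (measurable_frequency k).comp measurable_fst
  have h2 : Measurable fun ω : ScaledPhases => ω.2 k :=
    (measurable_pi_apply k).comp measurable_snd
  have h3 : Measurable fun ω : ScaledPhases => ((m * frequency k ω.1 : ℝ) : UnitAddCircle) :=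
    AddCircle.measurable_mk'.comp (measurable_const.mul h1)
  exact (h1.pow measurable_const).mul
    ((measurable_arc.comp (h3.add h2)).sub (measurable_arc.comp h2))

/-- High frequencies have geometrically decaying weights. At low frequencies the weights grow, but a
term is nonzero only if its phase lies close to an end of the arc; by Borel–Cantelli this happens
finitely often. Hence every `H > 0` is allowed. -/
theorem ae_summable_steppedTerm (hH : 0 < H) (m : ℕ) :
    ∀ᵐ ω ∂scaledPhasesLaw, Summable (steppedTerm H m ω) := by
  -- The factor `m + 1` instead of `m` gives the strict inequality required by `arc_add_eq`.
  set E : ℕ → Set ScaledPhases :=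
    fun k => (fun ω : ScaledPhases => ω.2 (k : ℤ)) ⁻¹' arcEnds ((m + 1) * (1 / 2) ^ k)
  have hE : ∀ k, scaledPhasesLaw (E k) ≤ ENNReal.ofReal (4 * ((m + 1) * (1 / 2) ^ k)) :=
    fun k => by
      rw [(measurePreserving_phase k).measure_preimage
        (measurableSet_arcEnds _).nullMeasurableSet]
      exact volume_arcEnds_le (by positivity)
  have hsum : ∑' k, scaledPhasesLaw (E k) ≠ ⊤ := by
    have h1 : Summable fun k : ℕ => 4 * (((m : ℝ) + 1) * (1 / 2) ^ k) :=
      (summable_geometric_two.mul_left _).mul_left _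
    refine ne_top_of_le_ne_top ?_ (ENNReal.tsum_le_tsum hE)
    rw [← ENNReal.ofReal_tsum_of_nonneg (fun k => by positivity) h1]
    exact ENNReal.ofReal_ne_top
  filter_upwards [ae_eventually_notMem hsum] with ω hω
  obtain ⟨N, hN⟩ := Filter.eventually_atTop.1 hω
  refine Summable.of_nat_of_neg_add_one ?_ ?_
  · refine summable_of_ne_finset_zero (s := Finset.range N) fun k hk => ?_
    have hk' : N ≤ k := by simpa using hk
    rw [steppedTerm, arc_add_eq _ (hN k hk'), sub_self, mul_zero]
    have h1 := frequency_le k ω.1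
    have h2 := frequency_pos k ω.1
    rw [abs_of_nonneg (by positivity)]
    calc (m : ℝ) * frequency k ω.1 ≤ m * (1 / 2) ^ k := by gcongr
      _ < _ := by gcongr; linarith
  · have h2 : (2 : ℝ) ^ (-H) < 1 := Real.rpow_lt_one_of_one_lt_of_neg one_lt_two (neg_neg_of_pos hH)
    refine Summable.of_norm_bounded
      (summable_geometric_of_lt_one (Real.rpow_nonneg zero_le_two _) h2) fun k => ?_
    have h3 := Real.rpow_pos_of_pos (frequency_pos (-(k + 1)) ω.1) (-H)
    rw [steppedTerm, Real.norm_eq_abs, abs_mul, abs_of_pos h3]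
    exact (mul_le_of_le_one_right h3.le (abs_arc_sub_le _ _)).trans (frequency_rpow_neg_le hH k _)

/-- Multiplying all frequencies by `n` rotates the logarithmic scale by `logb 2 n` and relabels the
indices; the uniform scale makes this work for all `n`, not only powers of two. -/
theorem exists_steppedProcess_rescale (H : ℝ) (n : ℕ+) :
    ∃ T : ScaledPhases → ScaledPhases, MeasurePreserving T scaledPhasesLaw scaledPhasesLaw ∧
      ∀ m ω, steppedProcess H (n * m) ω = ((n : ℕ) : ℝ) ^ H * steppedProcess H m (T ω) := by
  have hn : (0 : ℝ) < (n : ℕ) := by exact_mod_cast n.pos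
  set a : ℝ := Real.logb 2 (n : ℕ) with ha
  have h2a : (2 : ℝ) ^ a = (n : ℕ) := Real.rpow_logb two_pos (by norm_num) hn
  -- The quantity inside the floor is already an integer; the floor only makes it a measurable
  -- function to `ℤ`.
  set j : UnitAddCircle → ℤ :=
    fun u => ⌊representative (u - (a : UnitAddCircle)) - representative u + a⌋ with hj
  have hjm : Measurable j :=
    (((measurable_representative.comp (measurable_id.sub_const _)).sub
      measurable_representative).add_const a).floor
  have hja : ∀ u, representative (u - (a : UnitAddCircle)) = representative u - a + j u := by
    intro u
    have h1 : ((representative (u - (a : UnitAddCircle)) - representative u + a : ℝ) :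
        UnitAddCircle) = 0 := by
      rw [AddCircle.coe_add, AddCircle.coe_sub, coe_representative, coe_representative]
      abel
    obtain ⟨z, hz⟩ := (AddCircle.coe_eq_zero_iff 1).1 h1
    rw [zsmul_one] at hz
    have h2 : j u = z := by rw [hj]; simp only; rw [← hz, Int.floor_intCast]
    rw [h2]
    linarith
  refine ⟨_, measurePreserving_rescale (a : UnitAddCircle) hjm, fun m ω => ?_⟩
  have hfreq : ∀ k : ℤ, frequency k (ω.1 - (a : UnitAddCircle)) =
      (n : ℕ) * frequency (k + j ω.1) ω.1 := by
    intro k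
    rw [frequency, frequency, ← h2a, ← Real.rpow_add two_pos, hja]
    congr 1
    push_cast
    ring
  simp only [steppedProcess]
  rw [← tsum_mul_left, ← (Equiv.addRight (j ω.1)).tsum_eq]
  refine tsum_congr fun k => ?_
  simp only [Equiv.coe_addRight, steppedTerm]
  rw [hfreq, Real.mul_rpow hn.le (frequency_pos _ _).le, Real.rpow_neg hn.le]
  have h3 : ((n : ℕ) : ℝ) ^ H ≠ 0 := (Real.rpow_pos_of_pos hn H).ne'
  rw [mul_assoc, mul_inv_cancel_left₀ h3]
  rw [show ((n * m : ℕ) : ℝ) * frequency (k + j ω.1) ω.1 =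
    m * ((n : ℕ) * frequency (k + j ω.1) ω.1) by push_cast; ring]

theorem steppedTerm_shift (l m : ℕ) (ω : ScaledPhases) (k : ℤ) :
    steppedTerm H (m + l + 1) ω k - steppedTerm H (m + l) ω k =
      steppedTerm H (m + 1)
          (ω.1, fun k => ω.2 k + ((l * frequency k ω.1 : ℝ) : UnitAddCircle)) k -
        steppedTerm H m (ω.1, fun k => ω.2 k + ((l * frequency k ω.1 : ℝ) : UnitAddCircle)) k := by
  simp only [steppedTerm]
  rw [← mul_sub, ← mul_sub, sub_sub_sub_cancel_right, sub_sub_sub_cancel_right]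
  have key : ∀ x y : ℝ, x + l * frequency k ω.1 = y → ((y : ℝ) : UnitAddCircle) + ω.2 k =
      (x : UnitAddCircle) + (ω.2 k + ((l * frequency k ω.1 : ℝ) : UnitAddCircle)) := by
    rintro x _ rfl
    rw [AddCircle.coe_add]
    abel
  rw [← key _ (((m + l + 1 : ℕ) : ℝ) * frequency k ω.1) (by push_cast; ring),
    ← key _ (((m + l : ℕ) : ℝ) * frequency k ω.1) (by push_cast; ring)]

theorem exists_process_typeIII {b : ℕ+ → ℝ} (hb : TypeIII b) :
    ∃ (Ω : Type) (_ : MeasurableSpace Ω) (μ : Measure Ω) (_ : IsProbabilityMeasure μ)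
      (X : ℕ → Ω → ℝ), (∀ m : ℕ, Measurable (X m)) ∧ SelfSimilar μ X b ∧
        StationaryIncrements μ X ∧ ∀ c : ℝ, ¬ ∀ᵐ ω ∂μ, X 1 ω = c := by
  obtain ⟨H, hH, hbH⟩ := hb
  have hsum : ∀ᵐ ω ∂scaledPhasesLaw, ∀ m, Summable (steppedTerm H m ω) :=
    ae_all_iff.2 (ae_summable_steppedTerm hH)
  refine ⟨ScaledPhases, inferInstance, scaledPhasesLaw, inferInstance, steppedProcess H,
    measurable_steppedProcess, ?_, ?_, ?_⟩
  · refine selfSimilar_of_measurePreserving measurable_steppedProcess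
      (fun n => by rw [hbH]; exact Real.rpow_pos_of_pos (by exact_mod_cast n.pos) _) fun n => ?_
    rw [hbH]
    exact exists_steppedProcess_rescale H n
  · refine stationaryIncrements_of_measurePreserving measurable_steppedProcess fun l => ?_
    have hT := measurePreserving_translate
      (h := fun k u => ((l * frequency k u : ℝ) : UnitAddCircle)) fun k =>
        AddCircle.measurable_mk'.comp (measurable_const.mul (measurable_frequency k))
    refine ⟨_, hT, ?_⟩
    filter_upwards [hsum, hT.quasiMeasurePreserving.ae hsum] with ω h1 h2 m
    simp only [steppedProcess]
    rw [← (h1 _).tsum_sub (h1 _), ← (h2 _).tsum_sub (h2 _)]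
    exact tsum_congr fun k => steppedTerm_shift l m ω k
  · intro c hc
    -- Half a turn of the phase of index `2` alone preserves the law and alters one term. Index `2`
    -- is chosen because its frequency lies in `(1/8, 1/4]`, as `arc_second_difference_ne_zero`
    -- requires.
    have hT := measurePreserving_translate
      (h := fun k _ => if k = 2 then ((1 / 2 : ℝ) : UnitAddCircle) else 0)
      fun k => measurable_const
    set A := Metric.closedBall ((3 / 16 : ℝ) : UnitAddCircle) (1 / 32) with hA
    have hzero : ∀ᵐ ω ∂scaledPhasesLaw, ω.2 2 ∉ A := by
      filter_upwards [hsum, hT.quasiMeasurePreserving.ae hsum, ae_eq_comp_of_ae_const hT hc]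
        with ω h1 h2 h3 hmem
      simp only [steppedProcess] at h3
      rw [← sub_eq_zero, ← (h2 _).tsum_sub (h1 _), tsum_eq_single 2] at h3
      · simp only [steppedTerm, if_true, ← mul_sub, Nat.cast_one, one_mul] at h3
        have h4 := (mul_eq_zero.1 h3).resolve_left
          (Real.rpow_pos_of_pos (frequency_pos 2 ω.1) _).ne'
        refine arc_second_difference_ne_zero hmem ?_ ?_ h4
        · rw [show (1 / 8 : ℝ) = 2 ^ (-3 : ℝ) by
            rw [Real.rpow_neg zero_le_two]; norm_num, frequency]
          refine Real.rpow_lt_rpow_of_exponent_lt one_lt_two ?_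
          have := representative_lt_one ω.1
          push_cast
          linarith
        · exact (frequency_le 2 ω.1).trans (by norm_num)
      · intro k hk
        simp only [steppedTerm, hk, if_false, add_zero, sub_self]
    rw [ae_iff] at hzero
    simp only [not_not] at hzero
    have h5 := (measurePreserving_phase 2).measure_preimage (s := A)
      measurableSet_closedBall.nullMeasurableSet
    rw [hA, AddCircle.volume_closedBall] at h5
    have h6 : (0 : ENNReal) < ENNReal.ofReal (min 1 (2 * (1 / 32))) := by
      rw [ENNReal.ofReal_pos]; norm_num
    exact h6.ne (hzero.symm.trans h5)

end Archimedean

end DtSsSi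

theorem theoremt :
    -- every scaling function is of one of the three types
    (∀ {Ω : Type*} [MeasurableSpace Ω] (μ : Measure Ω) [IsProbabilityMeasure μ]
      (X : ℕ → Ω → ℝ) (b : ℕ+ → ℝ) (τ : ℕ+),
      DtSsSi.MarginallySelfSimilar μ X b →
      DtSsSi.MarginallyCyclostationaryIncrements μ X τ →
      (¬ ∀ᵐ ω ∂μ, X 1 ω = 0) →
      DtSsSi.TypeI b ∨ DtSsSi.TypeII b ∨ DtSsSi.TypeIII b) ∧
    -- the description of the second type through the values at the primes
    (∀ b : ℕ+ → ℝ, (∀ n : ℕ+, 0 < b n) → (∀ m n : ℕ+, b (m * n) = b m * b n) →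
      (DtSsSi.TypeII b ↔
        ∃ p : ℕ+, (p : ℕ).Prime ∧ b p < 1 ∧
          ∀ q : ℕ+, (q : ℕ).Prime → q ≠ p → b q = 1)) ∧
    -- every function of one of the three types is a scaling function
    (∀ b : ℕ+ → ℝ, DtSsSi.TypeI b ∨ DtSsSi.TypeII b ∨ DtSsSi.TypeIII b →
      ∃ (Ω : Type) (_ : MeasurableSpace Ω) (μ : Measure Ω) (_ : IsProbabilityMeasure μ)
        (X : ℕ → Ω → ℝ),
        (∀ m : ℕ, Measurable (X m)) ∧
        DtSsSi.SelfSimilar μ X b ∧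
        DtSsSi.StationaryIncrements μ X ∧
        ∀ c : ℝ, ¬ ∀ᵐ ω ∂μ, X 1 ω = c) := by
  refine ⟨?_, fun b hb0 hb => DtSsSi.typeII_iff hb0 hb, ?_⟩
  · intro Ω _ μ _ X b τ hss hci hne
    exact DtSsSi.scaling_classification hss hci hne
  · rintro b (hb | hb | hb)
    · exact DtSsSi.exists_process_typeI hb
    · exact DtSsSi.exists_process_typeII hb
    · exact DtSsSi.exists_process_typeIII hb
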